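/- Let $d\ge 1$ and let $X=(X_1,\dots,X_d)$ be an infinitely divisible random vector in $\mathbb R^d$ without Gaussian component and with i.i.d. coordinates: for some $\gamma\in\mathbb R^d$, $$\mathbb E e^{i\langle t,X\rangle}=\exp\Big\{i\langle t,\gamma\rangle+\int_{\mathbb R^d}\big(e^{i\langle t,u\rangle}-1-i\langle t,u\rangle\mathbf 1_{\|u\|_2\le 1}\big)\,\nu(du)\Big\},\qquad t\in\mathbb R^d,$$ where the Lévy measure $\nu\ne 0$ (a positive Borel measure with $\nu(\{0\})=0$ and $\int(1\wedge\|u\|_2^2)\,\nu(du)<\infty$) is carried by the coordinate axes, with the same one-dimensional Lévy measure $\tilde\nu$ on each axis, i.e. $\nu(dx_1,\dots,dx_d)=\sum_{k=1}^d\delta_0(dx_1)\cdots\delta_0(dx_{k-1})\,\tilde\nu(dx_k)\,\delta_0(dx_{k+1})\cdots\delta_0(dx_d)$. Assume that $\mathbb E e^{t\|X\|_2}<\infty$ for some $t>0$. Let $M=\sup\{t>0:\mathbb E e^{t|X_1|}<\infty\}\in(0,\infty]$, let $l=-\log\mathbb E[e^{-X_1^2}]$ and, for $0<t<M$, let $$g(t)=\Big(8+\frac{12\log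 2}{l}\Big)\int_{\mathbb R}|u|\,(e^{t|u|}-1)\,\tilde\nu(du)+\frac 8l\int_{\mathbb R}|u|^3(e^{t|u|}-1)\,\tilde\nu(du).$$ Then $l>0$, $\mathbb E\|X\|_2<\infty$, both integrals in $g(t)$ are finite for $0<t<M$, and for every real $T$ with $0\le T\le M$ such that $t\,g(t)\le\frac12$ for all $0<t\le T$ with $t<M$, the function $g$ is integrable on $(0,T)$ and, for all $x>0$, $$\mathbb P\big(\|X\|_2\ge\mathbb E\|X\|_2+x\big)\le\exp\Big(-\sup_{0\le t\le T}\Big[tx-\int_0^t2g(s)\,ds\Big]\Big).$$ -/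

import Mathlib

open MeasureTheory ProbabilityTheory Complex
open scoped RealInnerProductSpace

noncomputable section

/-- A Lévy measure on a Euclidean space (or on `ℝ`): no atom at the origin, and
`1 ∧ ‖u‖ ^ 2` has a finite integral. -/
structure IsLevyMeasure {E : Type*} [NormedAddCommGroup E] [MeasurableSpace E]
    (ν : Measure E) : Prop where
  zero_atom : ν {0} = 0
  lintegral_lt_top : ∫⁻ u, ENNReal.ofReal (min 1 (‖u‖ ^ 2)) ∂ν < ⊤

/-- The exponent of the Lévy-Khintchine formula without Gaussian part, with drift `γ`, Lévy measure
`ν` and truncation function `1_{‖u‖ ≤ 1}`. -/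
def levyExponent {E : Type*} [NormedAddCommGroup E] [InnerProductSpace ℝ E] [MeasurableSpace E]
    (γ : E) (ν : Measure E) (t : E) : ℂ :=
  I * ((⟪t, γ⟫ : ℝ) : ℂ) +
    ∫ u, (Complex.exp (I * ((⟪t, u⟫ : ℝ) : ℂ)) - 1 -
      (Metric.closedBall (0 : E) 1).indicator (fun v => I * ((⟪t, v⟫ : ℝ) : ℂ)) u) ∂ν

/-- The random vector `X` is infinitely divisible without Gaussian component, with drift `γ` and
Lévy measure `ν`: its characteristic function is given by the Lévy-Khintchine formula. -/
structure IsInfDivVector {Ω : Type*} [MeasurableSpace Ω] {E : Type*} [NormedAddCommGroup E]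
    [InnerProductSpace ℝ E] [MeasurableSpace E] (X : Ω → E) (P : Measure Ω) (γ : E)
    (ν : Measure E) : Prop where
  aemeasurable : AEMeasurable X P
  isLevyMeasure : IsLevyMeasure ν
  charFun_eq : ∀ t : E, charFun (P.map X) t = Complex.exp (levyExponent γ ν t)

/-- The measure on `ℝ ^ d` which is supported on the axes and puts a copy of `ρ` on each axis:
`∑ₖ δ₀ ⊗ ⋯ ⊗ δ₀ ⊗ ρ ⊗ δ₀ ⊗ ⋯ ⊗ δ₀`, with `ρ` in position `k`. -/
def axesMeasure (d : ℕ) (ρ : Measure ℝ) : Measure (EuclideanSpace ℝ (Fin d)) :=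
  ∑ k : Fin d, ρ.map (fun u : ℝ => EuclideanSpace.single k u)

/-- `M = sup {t > 0 : E exp (t |Y|) < ∞}`, an extended real number. -/
def expMomentSup {Ω : Type*} [MeasurableSpace Ω] (Y : Ω → ℝ) (P : Measure Ω) : EReal :=
  ⨆ (t : ℝ) (_ : 0 < t ∧ Integrable (fun ω => Real.exp (t * |Y ω|)) P), (t : EReal)

/-- `l = - log E exp (-Y ^ 2)`. -/
def negLogLaplaceSq {Ω : Type*} [MeasurableSpace Ω] (Y : Ω → ℝ) (P : Measure Ω) : ℝ :=
  -Real.log (∫ ω, Real.exp (-(Y ω) ^ 2) ∂P)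

/-- The rate function
`g(t) = (8 + 12 log 2 / l) ∫ |u| (e^{t|u|} - 1) ρ(du) + (8 / l) ∫ |u|³ (e^{t|u|} - 1) ρ(du)`. -/
def rateFun (ρ : Measure ℝ) (l t : ℝ) : ℝ :=
  (8 + 12 * Real.log 2 / l) * (∫ u, |u| * (Real.exp (t * |u|) - 1) ∂ρ) +
    8 / l * ∫ u, |u| ^ 3 * (Real.exp (t * |u|) - 1) ∂ρ

end

/-!
The proof bounds the Laplace transform of `F = ‖X‖` by a differential inequality (Herbst's argument)
in which the covariance `Cov(F, e ^ (t F))` is computed from the jumps of `X`.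

For a compound Poisson law with finite Lévy measure `ν`, interpolation between the independent and
the diagonal coupling of two copies gives a probability measure `Π` with both marginals equal to the
law and `Cov(f, g) = ∫ (f(U + u) - f(U)) (g(V + u) - g(V)) dΠ(U, V) dν(u)`
(`integral_mul_sub_eq_integral_covCoupling`; both sides are finite measures tested against
`f ⊗ g`, and the measures have the same characteristic function). When `ν` is carried by the axes,
the jumps are `x e_k`. By convexity of `exp` and the arithmetic-geometric mean inequality the two
increments decouple, and the sum over `k` of the squared increments of the norm is at most
`8 x² + 4 x⁴ / l`, whatever the dimension, as long as `‖U‖² ≥ l d / 2`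
(`sum_sq_norm_add_single_sub_norm_le`). The remaining event is unlikely, because
`E e ^ (-‖X‖²) = e ^ (-l d)`; under the density proportional to `e ^ (t F)` its contribution is
controlled by the entropy inequality (`integral_mul_exp_le`), at the price of a multiple of
`t Cov(F, e ^ (t F))`. The condition `t g(t) ≤ 1 / 2` absorbs this term on the left
(`cov_norm_exp_norm_le`), so that `(log E e ^ (t F))' ≤ E F + 2 g(t)`, and integration gives
`E e ^ (t F) ≤ exp (t E F + ∫₀ᵗ 2 g)` (`integral_exp_norm_le`).

A general `X` is approximated by removing the jumps of norm at most `1 / (n + 1)`. These laws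
converge weakly by Lévy's continuity theorem, their exponential moments are bounded uniformly, and
their rate functions do not exceed `g`, so the inequality passes to the limit
(`integral_exp_norm_le_of_levyApprox`). The uniform bounds need exponential moments of the Lévy
measure, which are inherited from those of `X` (`integrableOn_exp_norm_of_integrable`). Markov's
inequality for `e ^ (t F)` then gives the tail bound for `t < T`, and continuity in `t` the endpoint
`T`, which may be equal to `M`.
-/

open Filter Topology
open scoped NNReal ENNReal

/-! ### Compound Poisson laws -/

section CompoundPoisson

open scoped Nat

variable {E : Type*} [NormedAddCommGroup E] [MeasurableSpace E]

/-- The `n`-fold convolution power of a measure, with the unit mass at `0` for `n = 0`. -/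
noncomputable def convPow (ν : Measure E) : ℕ → Measure E
  | 0 => Measure.dirac 0
  | n + 1 => convPow ν n ∗ ν

/-- The compound Poisson law with Lévy measure `r • ν`, as the Poisson mixture
`∑ₙ e ^ (-r λ) (r ^ n / n!) ν ^ (∗ n)` with `λ` the total mass of `ν`. The time parameter `r` is
kept apart from `ν` so that the law is visibly measurable in `r`. -/
noncomputable def compoundPoisson (ν : Measure E) (r : ℝ≥0) : Measure E :=
  Measure.sum fun n : ℕ =>
    ENNReal.ofReal (Real.exp (-(r * ν.real Set.univ)) * ((r : ℝ) ^ n / n !)) • convPow ν n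

lemma measurable_compoundPoisson (ν : Measure E) : Measurable (compoundPoisson ν) := by
  refine Measure.measurable_of_measurable_coe _ fun s hs => ?_
  simp only [compoundPoisson, Measure.sum_apply _ hs, Measure.smul_apply, smul_eq_mul]
  fun_prop

variable [BorelSpace E] [SecondCountableTopology E]

instance isFiniteMeasure_convPow (ν : Measure E) [IsFiniteMeasure ν] (n : ℕ) :
    IsFiniteMeasure (convPow ν n) := by
  induction n with
  | zero => simp only [convPow]; infer_instance
  | succ n ih => simp only [convPow]; infer_instance

lemma charFunDual_convPow [NormedSpace ℝ E] (ν : Measure E) [IsFiniteMeasure ν] (n : ℕ)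
    (L : StrongDual ℝ E) : charFunDual (convPow ν n) L = charFunDual ν L ^ n := by
  induction n with
  | zero => simp [convPow, charFunDual_dirac]
  | succ n ih => simp only [convPow]; rw [charFunDual_conv, ih, pow_succ]

lemma lintegral_convPow_le (ν : Measure E) [IsFiniteMeasure ν] {χ : E → ℝ≥0∞}
    (hχ : Measurable χ) (h0 : χ 0 ≤ 1) (hmul : ∀ x y, χ (x + y) ≤ χ x * χ y) (n : ℕ) :
    ∫⁻ x, χ x ∂(convPow ν n) ≤ (∫⁻ x, χ x ∂ν) ^ n := by
  induction n with
  | zero => simpa [convPow, lintegral_dirac' _ hχ] using h0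
  | succ n ih =>
    simp only [convPow]
    rw [Measure.lintegral_conv hχ]
    calc ∫⁻ x, ∫⁻ y, χ (x + y) ∂ν ∂(convPow ν n)
        ≤ ∫⁻ x, χ x * (∫⁻ y, χ y ∂ν) ∂(convPow ν n) := by
          refine lintegral_mono fun x => ?_
          rw [← lintegral_const_mul _ hχ]
          exact lintegral_mono fun y => hmul x y
      _ = (∫⁻ x, χ x ∂(convPow ν n)) * ∫⁻ y, χ y ∂ν := lintegral_mul_const _ hχ
      _ ≤ _ := by rw [pow_succ]; gcongr

/-- Exponential bound for the compound Poisson integral of a submultiplicative function. -/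
lemma lintegral_compoundPoisson_le (ν : Measure E) [IsFiniteMeasure ν] (r : ℝ≥0) {χ : E → ℝ≥0∞}
    (hχ : Measurable χ) (h0 : χ 0 ≤ 1) (hmul : ∀ x y, χ (x + y) ≤ χ x * χ y) {m : ℝ} (hm : 0 ≤ m)
    (hνm : ∫⁻ x, χ x ∂ν ≤ ENNReal.ofReal m) :
    ∫⁻ x, χ x ∂(compoundPoisson ν r)
      ≤ ENNReal.ofReal (Real.exp (r * (m - ν.real Set.univ))) := by
  have hs : HasSum (fun n : ℕ => Real.exp (-(r * ν.real Set.univ)) * ((r : ℝ) ^ n / n !) * m ^ n)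
      (Real.exp (r * (m - ν.real Set.univ))) := by
    have h1 := (NormedSpace.expSeries_div_hasSum_exp ((r : ℝ) * m)).mul_left
      (Real.exp (-(r * ν.real Set.univ)))
    rw [← Real.exp_eq_exp_ℝ, ← Real.exp_add] at h1
    have e1 : (r : ℝ) * (m - ν.real Set.univ) = -(r * ν.real Set.univ) + r * m := by ring
    rw [e1]
    refine h1.congr_fun fun n => ?_
    rw [mul_pow]
    ring
  rw [compoundPoisson, lintegral_sum_measure, ← hs.tsum_eq,
    ENNReal.ofReal_tsum_of_nonneg (fun n => by positivity) hs.summable]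
  refine ENNReal.tsum_le_tsum fun n => ?_
  rw [lintegral_smul_measure, smul_eq_mul, ENNReal.ofReal_mul (q := m ^ n) (by positivity),
    ENNReal.ofReal_pow hm]
  gcongr
  exact (lintegral_convPow_le ν hχ h0 hmul n).trans (by gcongr)

instance isFiniteMeasure_compoundPoisson (ν : Measure E) [IsFiniteMeasure ν] (r : ℝ≥0) :
    IsFiniteMeasure (compoundPoisson ν r) := by
  refine ⟨?_⟩
  have := lintegral_compoundPoisson_le ν r (χ := fun _ => 1) measurable_const le_rfl
    (fun _ _ => by simp) (m := ν.real Set.univ) (by positivity) (by simp)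
  rw [lintegral_one] at this
  exact this.trans_lt ENNReal.ofReal_lt_top

/-- The Lévy-Khintchine formula for the compound Poisson law. -/
lemma charFunDual_compoundPoisson [NormedSpace ℝ E] (ν : Measure E) [IsFiniteMeasure ν] (r : ℝ≥0)
    (L : StrongDual ℝ E) :
    charFunDual (compoundPoisson ν r) L =
      Complex.exp (r * (charFunDual ν L - (ν.real Set.univ : ℝ))) := by
  rw [charFunDual, compoundPoisson]
  have hint : Integrable (fun v => BoundedContinuousFunction.probCharDual L v)
      (compoundPoisson ν r) :=
    BoundedContinuousFunction.integrable _ _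
  have h := hasSum_integral_measure hint
  refine h.unique ?_
  have h1 := (NormedSpace.expSeries_div_hasSum_exp ((r : ℂ) * charFunDual ν L)).mul_left
      (Complex.exp (-(r * (ν.real Set.univ : ℝ))))
  rw [← Complex.exp_eq_exp_ℂ, ← Complex.exp_add] at h1
  have e1 : (r : ℂ) * (charFunDual ν L - (ν.real Set.univ : ℝ))
      = -(r * (ν.real Set.univ : ℝ)) + r * charFunDual ν L := by ring
  rw [e1]
  refine h1.congr_fun fun n => ?_
  have h2 := charFunDual_convPow ν n L
  rw [charFunDual] at h2
  rw [integral_smul_measure, ENNReal.toReal_ofReal (by positivity), h2, Complex.real_smul, mul_pow]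
  push_cast
  ring

instance isProbabilityMeasure_compoundPoisson [NormedSpace ℝ E] (ν : Measure E)
    [IsFiniteMeasure ν] (r : ℝ≥0) : IsProbabilityMeasure (compoundPoisson ν r) := by
  have h := charFunDual_compoundPoisson ν r 0
  have h2 : charFunDual ν 0 = (ν.real Set.univ : ℝ) := by simp [charFunDual_apply]
  rw [h2] at h
  simp [charFunDual_apply] at h
  refine ⟨?_⟩
  have h3 : (compoundPoisson ν r).real Set.univ = 1 := by exact_mod_cast h
  rw [measureReal_def] at h3
  rwa [ENNReal.toReal_eq_one_iff] at h3

/-- Exactly one jump occurs with probability `r λ e ^ (-r λ)`, so the compound Poisson law dominates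
a multiple of its Lévy measure. -/
lemma smul_le_compoundPoisson_one (ν : Measure E) [IsFiniteMeasure ν] :
    ENNReal.ofReal (Real.exp (-(ν.real Set.univ))) • ν ≤ compoundPoisson ν 1 := by
  have h := Measure.le_sum (fun n : ℕ =>
    ENNReal.ofReal (Real.exp (-(((1 : ℝ≥0) : ℝ) * ν.real Set.univ)) * ((((1 : ℝ≥0) : ℝ)) ^ n / n !))
      • convPow ν n) 1
  simpa [compoundPoisson, convPow] using h

/-- The law of `a + Y` with `Y` compound Poisson with Lévy measure `ν`. -/
noncomputable def shiftedCompoundPoisson (a : E) (ν : Measure E) : Measure E :=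
  (compoundPoisson ν 1).map (a + ·)

lemma integrable_exp_norm_shiftedCompoundPoisson (a : E) (ν : Measure E) [IsFiniteMeasure ν]
    {c : ℝ} (hc : 0 ≤ c) (hν : Integrable (fun u => Real.exp (c * ‖u‖)) ν) :
    Integrable (fun x => Real.exp (c * ‖x‖)) (shiftedCompoundPoisson a ν) := by
  have h0 : Integrable (fun x => Real.exp (c * ‖x‖)) (compoundPoisson ν 1) := by
    refine ⟨by fun_prop, ?_⟩
    rw [hasFiniteIntegral_iff_ofReal (ae_of_all _ fun _ => by positivity)]
    refine (lintegral_compoundPoisson_le ν 1 (χ := fun x => ENNReal.ofReal (Real.exp (c * ‖x‖)))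
      (by fun_prop) (by simp) (fun x y => ?_)
      (m := ∫ u, Real.exp (c * ‖u‖) ∂ν) (by positivity) ?_).trans_lt ENNReal.ofReal_lt_top
    · rw [← ENNReal.ofReal_mul (by positivity), ← Real.exp_add, ← mul_add]
      gcongr
      exact norm_add_le x y
    · rw [ofReal_integral_eq_lintegral_ofReal hν (ae_of_all _ fun _ => by positivity)]
  rw [shiftedCompoundPoisson, integrable_map_measure (by fun_prop) (by fun_prop)]
  refine (h0.const_mul (Real.exp (c * ‖a‖))).mono' (by fun_prop) (ae_of_all _ fun x => ?_)
  simp only [Function.comp_apply, Real.norm_eq_abs, Real.abs_exp]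
  rw [← Real.exp_add, ← mul_add]
  gcongr
  exact norm_add_le a x

end CompoundPoisson

/-! ### The covariance representation for finite Lévy measures -/

section Covariance

/-- For `t < c` the products `‖x‖ e ^ (t ‖y‖)` which occur in the covariance representation are
dominated by an integrable function. -/
lemma norm_mul_exp_norm_le {F : Type*} [NormedAddCommGroup F] {t c : ℝ} (ht : 0 ≤ t)
    (htc : t < c) {x y U V u : F} (hx : ‖x‖ ≤ ‖U‖ + ‖u‖) (hy : ‖y‖ ≤ ‖V‖ + ‖u‖) :
    ‖x‖ * Real.exp (t * ‖y‖) ≤ (c - t)⁻¹ *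
      ((Real.exp (c * ‖U‖) + Real.exp (c * ‖V‖)) * Real.exp (c * ‖u‖)) := by
  have hε : 0 < c - t := sub_pos.2 htc
  have h1 : ‖x‖ ≤ (c - t)⁻¹ * Real.exp ((c - t) * (‖U‖ + ‖u‖)) := by
    rw [inv_mul_eq_div, le_div_iff₀ hε]
    nlinarith [Real.add_one_le_exp ((c - t) * (‖U‖ + ‖u‖))]
  have h2 : Real.exp (t * ‖y‖) ≤ Real.exp (t * (‖V‖ + ‖u‖)) := by gcongr
  have h3 : Real.exp ((c - t) * ‖U‖ + t * ‖V‖) ≤ Real.exp (c * ‖U‖) + Real.exp (c * ‖V‖) := by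
    rcases le_total ‖U‖ ‖V‖ with h | h
    · have : Real.exp ((c - t) * ‖U‖ + t * ‖V‖) ≤ Real.exp (c * ‖V‖) := by
        apply Real.exp_le_exp.2; nlinarith
      linarith [Real.exp_pos (c * ‖U‖)]
    · have : Real.exp ((c - t) * ‖U‖ + t * ‖V‖) ≤ Real.exp (c * ‖U‖) := by
        apply Real.exp_le_exp.2; nlinarith
      linarith [Real.exp_pos (c * ‖V‖)]
  calc ‖x‖ * Real.exp (t * ‖y‖)
      ≤ ((c - t)⁻¹ * Real.exp ((c - t) * (‖U‖ + ‖u‖))) * Real.exp (t * (‖V‖ + ‖u‖)) := by gcongr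
    _ = (c - t)⁻¹ * (Real.exp ((c - t) * ‖U‖ + t * ‖V‖) * Real.exp (c * ‖u‖)) := by
        rw [mul_assoc, ← Real.exp_add, ← Real.exp_add]; congr 2; ring
    _ ≤ _ := by gcongr

lemma integrable_norm_mul_exp_norm_shiftedCompoundPoisson {F : Type*}
    [NormedAddCommGroup F] [MeasurableSpace F] [BorelSpace F] [SecondCountableTopology F]
    {ν : Measure F} [IsFiniteMeasure ν] {t c : ℝ} (a : F) (ht : 0 ≤ t) (htc : t < c)
    (hν : Integrable (fun u => Real.exp (c * ‖u‖)) ν) :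
    Integrable (fun x => ‖x‖ * Real.exp (t * ‖x‖)) (shiftedCompoundPoisson a ν) := by
  have h := integrable_exp_norm_shiftedCompoundPoisson a ν (ht.trans htc.le) hν
  refine ((h.add h).const_mul (c - t)⁻¹).mono' (by fun_prop) (ae_of_all _ fun x => ?_)
  rw [Real.norm_of_nonneg (by positivity)]
  simpa using norm_mul_exp_norm_le ht htc (x := x) (y := x) (U := x) (V := x) (u := 0)
    (by simp) (by simp)

variable {E : Type*} [NormedAddCommGroup E] [NormedSpace ℝ E] [MeasurableSpace E]

/-- The compound Poisson laws along a measurable change of time, as a kernel. -/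
noncomputable def compoundPoissonKernel (ν : Measure E) (f : ℝ → ℝ≥0) (hf : Measurable f) :
    Kernel ℝ E :=
  ⟨fun z => compoundPoisson ν (f z), (measurable_compoundPoisson ν).comp hf⟩

/-- Time `z` of the interpolation between the independent and the diagonal coupling: the law of
`(a + A + B, a + A + C)` with `A`, `B`, `C` independent compound Poisson variables with Lévy
measures `z ν`, `(1 - z) ν`, `(1 - z) ν`. -/
noncomputable def couplingKernel (a : E) (ν : Measure E) : Kernel ℝ (E × E) :=
  (compoundPoissonKernel ν (fun z => z.toNNReal) (by fun_prop) ×ₖ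
    (compoundPoissonKernel ν (fun z => (1 - z).toNNReal) (by fun_prop) ×ₖ
      compoundPoissonKernel ν (fun z => (1 - z).toNNReal) (by fun_prop))).map
        fun p => ((a, a) : E × E) + (p.1 + p.2.1, p.1 + p.2.2)

/-- The coupling of the covariance representation: the interpolation `couplingKernel` averaged
over a uniform time in `(0, 1]`. -/
noncomputable def covCoupling (a : E) (ν : Measure E) : Measure (E × E) :=
  couplingKernel a ν ∘ₘ (volume.restrict (Set.Ioc (0 : ℝ) 1))

lemma charFunDual_zero_eq_measureReal (m : Measure E) :
    charFunDual m 0 = (m.real Set.univ : ℝ) := by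
  simp [charFunDual_apply]

variable [BorelSpace E] [SecondCountableTopology E]

instance (a : E) (ν : Measure E) [IsFiniteMeasure ν] :
    IsProbabilityMeasure (shiftedCompoundPoisson a ν) :=
  Measure.isProbabilityMeasure_map (by fun_prop)

lemma charFunDual_shiftedCompoundPoisson (a : E) (ν : Measure E) [IsFiniteMeasure ν]
    (L : StrongDual ℝ E) : charFunDual (shiftedCompoundPoisson a ν) L =
      Complex.exp (L a * I + (charFunDual ν L - (ν.real Set.univ : ℝ))) := by
  rw [shiftedCompoundPoisson, charFunDual_map_const_add, charFunDual_compoundPoisson,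
    ← Complex.exp_add]
  simp [add_comm]

instance (ν : Measure E) [IsFiniteMeasure ν] (f : ℝ → ℝ≥0) (hf : Measurable f) :
    IsMarkovKernel (compoundPoissonKernel ν f hf) :=
  ⟨fun z => isProbabilityMeasure_compoundPoisson ν (f z)⟩

instance (a : E) (ν : Measure E) [IsFiniteMeasure ν] : IsMarkovKernel (couplingKernel a ν) :=
  Kernel.IsMarkovKernel.map _ (by fun_prop)

lemma charFunDual_couplingKernel (a : E) (ν : Measure E) [IsFiniteMeasure ν] {z : ℝ}
    (hz : z ∈ Set.Ioc (0 : ℝ) 1) (L : StrongDual ℝ (E × E)) :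
    charFunDual (couplingKernel a ν z) L =
      Complex.exp (((L.comp (.inl ℝ E E) + L.comp (.inr ℝ E E)) a : ℝ) * I +
        (charFunDual ν (L.comp (.inl ℝ E E)) + charFunDual ν (L.comp (.inr ℝ E E))
          - 2 * (ν.real Set.univ : ℝ)) +
        z * (charFunDual ν (L.comp (.inl ℝ E E) + L.comp (.inr ℝ E E)) + (ν.real Set.univ : ℝ)
          - charFunDual ν (L.comp (.inl ℝ E E)) - charFunDual ν (L.comp (.inr ℝ E E)))) := by
  let T : E × (E × E) →L[ℝ] E × E :=
    ((ContinuousLinearMap.fst ℝ E (E × E)) + (ContinuousLinearMap.fst ℝ E E).comp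
      (ContinuousLinearMap.snd ℝ E (E × E))).prod
    ((ContinuousLinearMap.fst ℝ E (E × E)) + (ContinuousLinearMap.snd ℝ E E).comp
      (ContinuousLinearMap.snd ℝ E (E × E)))
  have e : couplingKernel a ν z =
      (((compoundPoisson ν z.toNNReal).prod ((compoundPoisson ν (1 - z).toNNReal).prod
        (compoundPoisson ν (1 - z).toNNReal))).map T).map (((a, a) : E × E) + ·) := by
    rw [Measure.map_map (by fun_prop) (by fun_prop), couplingKernel,
      Kernel.map_apply _ (by fun_prop), Kernel.prod_apply, Kernel.prod_apply]
    rfl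
  have e1 : (L.comp T).comp (.inl ℝ E (E × E)) = L.comp (.inl ℝ E E) + L.comp (.inr ℝ E E) := by
    ext x
    simp [T, ← map_add]
  have e2 : ((L.comp T).comp (.inr ℝ E (E × E))).comp (.inl ℝ E E) = L.comp (.inl ℝ E E) := by
    ext x
    simp [T]
  have e3 : ((L.comp T).comp (.inr ℝ E (E × E))).comp (.inr ℝ E E) = L.comp (.inr ℝ E E) := by
    ext x
    simp [T]
  have e4 : L (a, a) = (L.comp (.inl ℝ E E) + L.comp (.inr ℝ E E)) a := by
    simp [← map_add]
  rw [e, charFunDual_map_const_add, charFunDual_map, charFunDual_prod, charFunDual_prod, e1, e2, e3,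
    charFunDual_compoundPoisson, charFunDual_compoundPoisson, charFunDual_compoundPoisson, e4,
    ← Complex.exp_add, ← Complex.exp_add, ← Complex.exp_add]
  have hz1 : ((z.toNNReal : ℝ) : ℂ) = z := by rw [Real.coe_toNNReal z hz.1.le]
  have hz2 : (((1 - z).toNNReal : ℝ) : ℂ) = 1 - z := by
    rw [Real.coe_toNNReal (1 - z) (by linarith [hz.2])]; push_cast; rfl
  rw [hz1, hz2]
  congr 1
  ring

instance (a : E) (ν : Measure E) [IsFiniteMeasure ν] : IsProbabilityMeasure (covCoupling a ν) := by
  have : IsProbabilityMeasure (volume.restrict (Set.Ioc (0 : ℝ) 1)) := ⟨by simp⟩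
  unfold covCoupling
  infer_instance

lemma charFunDual_covCoupling (a : E) (ν : Measure E) [IsFiniteMeasure ν]
    (L : StrongDual ℝ (E × E)) :
    charFunDual (covCoupling a ν) L = ∫ z in Set.Ioc (0 : ℝ) 1,
      Complex.exp (((L.comp (.inl ℝ E E) + L.comp (.inr ℝ E E)) a : ℝ) * I +
        (charFunDual ν (L.comp (.inl ℝ E E)) + charFunDual ν (L.comp (.inr ℝ E E))
          - 2 * (ν.real Set.univ : ℝ)) +
        z * (charFunDual ν (L.comp (.inl ℝ E E) + L.comp (.inr ℝ E E)) + (ν.real Set.univ : ℝ)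
          - charFunDual ν (L.comp (.inl ℝ E E)) - charFunDual ν (L.comp (.inr ℝ E E)))) := by
  have h : IsProbabilityMeasure (covCoupling a ν) := inferInstance
  rw [← setIntegral_congr_fun measurableSet_Ioc fun z hz => charFunDual_couplingKernel a ν hz L]
  rw [covCoupling, Measure.comp_eq_comp_const_apply] at h ⊢
  rw [charFunDual, Kernel.integral_comp (BoundedContinuousFunction.integrable _ _),
    Kernel.const_apply]
  rfl

/-- The second factor is `∫ (e ^ (i L₁ u) - 1) (e ^ (i L₂ u) - 1) ν(du)`. -/
lemma charFunDual_covCoupling_mul (a : E) (ν : Measure E) [IsFiniteMeasure ν]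
    (L : StrongDual ℝ (E × E)) :
    charFunDual (covCoupling a ν) L *
      (charFunDual ν (L.comp (.inl ℝ E E) + L.comp (.inr ℝ E E)) + (ν.real Set.univ : ℝ)
          - charFunDual ν (L.comp (.inl ℝ E E)) - charFunDual ν (L.comp (.inr ℝ E E))) =
      charFunDual (shiftedCompoundPoisson a ν) (L.comp (.inl ℝ E E) + L.comp (.inr ℝ E E)) -
        charFunDual (shiftedCompoundPoisson a ν) (L.comp (.inl ℝ E E)) *
          charFunDual (shiftedCompoundPoisson a ν) (L.comp (.inr ℝ E E)) := by
  simp only [charFunDual_shiftedCompoundPoisson, charFunDual_covCoupling]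
  set w := charFunDual ν (L.comp (.inl ℝ E E) + L.comp (.inr ℝ E E)) + (ν.real Set.univ : ℝ)
          - charFunDual ν (L.comp (.inl ℝ E E)) - charFunDual ν (L.comp (.inr ℝ E E)) with hw
  -- `w` times the integrand is the derivative in `z`; `w` may vanish, so it stays on this side.
  rw [← intervalIntegral.integral_of_le zero_le_one, ← intervalIntegral.integral_mul_const,
    intervalIntegral.integral_eq_sub_of_hasDerivAt (f := fun z : ℝ =>
      Complex.exp (((L.comp (.inl ℝ E E) + L.comp (.inr ℝ E E)) a : ℝ) * I +
        (charFunDual ν (L.comp (.inl ℝ E E)) + charFunDual ν (L.comp (.inr ℝ E E))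
          - 2 * (ν.real Set.univ : ℝ)) + z * w))]
  · rw [← Complex.exp_add]
    congr 2
    · simp only [hw, ofReal_one]; ring
    · simp only [ofReal_zero, add_apply]; push_cast; ring
  · intro z _
    have h := (((hasDerivAt_id (z : ℂ)).mul_const w).const_add
      (((L.comp (.inl ℝ E E) + L.comp (.inr ℝ E E)) a : ℝ) * I +
        (charFunDual ν (L.comp (.inl ℝ E E)) + charFunDual ν (L.comp (.inr ℝ E E))
          - 2 * (ν.real Set.univ : ℝ)))).cexp.comp_ofReal
    simpa using h
  · exact Continuous.intervalIntegrable (by fun_prop) _ _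

lemma map_fst_covCoupling [CompleteSpace E] (a : E) (ν : Measure E) [IsFiniteMeasure ν] :
    (covCoupling a ν).map Prod.fst = shiftedCompoundPoisson a ν := by
  refine Measure.ext_of_charFunDual (funext fun L => ?_)
  have e1 : (L.comp (.fst ℝ E E)).comp (.inl ℝ E E) = L := by ext; simp
  have e2 : (L.comp (.fst ℝ E E)).comp (.inr ℝ E E) = 0 := by ext; simp
  have h := charFunDual_map (μ := covCoupling a ν) (ContinuousLinearMap.fst ℝ E E) L
  rw [ContinuousLinearMap.coe_fst'] at h
  rw [h, charFunDual_covCoupling, e1, e2, charFunDual_shiftedCompoundPoisson,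
    charFunDual_zero_eq_measureReal]
  simp
  congr 1
  ring

lemma map_snd_covCoupling [CompleteSpace E] (a : E) (ν : Measure E) [IsFiniteMeasure ν] :
    (covCoupling a ν).map Prod.snd = shiftedCompoundPoisson a ν := by
  refine Measure.ext_of_charFunDual (funext fun L => ?_)
  have e1 : (L.comp (.snd ℝ E E)).comp (.inr ℝ E E) = L := by ext; simp
  have e2 : (L.comp (.snd ℝ E E)).comp (.inl ℝ E E) = 0 := by ext; simp
  have h := charFunDual_map (μ := covCoupling a ν) (ContinuousLinearMap.snd ℝ E E) L
  rw [ContinuousLinearMap.coe_snd'] at h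
  rw [h, charFunDual_covCoupling, e1, e2, charFunDual_shiftedCompoundPoisson,
    charFunDual_zero_eq_measureReal]
  simp
  congr 1
  ring

/-- The covariance representation as an identity between finite measures on `E × E`, with the
negative terms moved to the other side. Both sides have the same characteristic function. -/
lemma map_covCoupling_add_eq [CompleteSpace E] (a : E) (ν : Measure E) [IsFiniteMeasure ν] :
    (shiftedCompoundPoisson a ν).map (fun x => (x, x))
      + (((covCoupling a ν).prod ν).map (fun p => (p.1.1 + p.2, p.1.2))
        + ((covCoupling a ν).prod ν).map (fun p => (p.1.1, p.1.2 + p.2))) =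
    (shiftedCompoundPoisson a ν).prod (shiftedCompoundPoisson a ν)
      + (((covCoupling a ν).prod ν).map (fun p => (p.1.1 + p.2, p.1.2 + p.2))
        + ((covCoupling a ν).prod ν).map (fun p => p.1)) := by
  refine Measure.ext_of_charFunDual (funext fun L => ?_)
  have hadd : ∀ (m₁ m₂ : Measure (E × E)) [IsFiniteMeasure m₁] [IsFiniteMeasure m₂],
      charFunDual (m₁ + m₂) L = charFunDual m₁ L + charFunDual m₂ L := fun m₁ m₂ _ _ =>
    integral_add_measure (BoundedContinuousFunction.integrable _ _)
      (BoundedContinuousFunction.integrable _ _)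
  let f1 : (E × E) × E →L[ℝ] E := (ContinuousLinearMap.fst ℝ E E).comp (.fst ℝ (E × E) E)
  let f2 : (E × E) × E →L[ℝ] E := (ContinuousLinearMap.snd ℝ E E).comp (.fst ℝ (E × E) E)
  let f3 : (E × E) × E →L[ℝ] E := .snd ℝ (E × E) E
  have hT : ∀ T : (E × E) × E →L[ℝ] E × E, (∀ p, T (p, 0) = p) →
      charFunDual (((covCoupling a ν).prod ν).map T) L =
        charFunDual (covCoupling a ν) L * charFunDual ν ((L.comp T).comp (.inr ℝ (E × E) E)) := by
    intro T hT
    rw [charFunDual_map, charFunDual_prod]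
    congr 2
    refine ContinuousLinearMap.ext fun p => ?_
    simp [hT]
  have h1 := hT ((f1 + f3).prod f2) (by simp [f1, f2, f3])
  have h2 := hT (f1.prod (f2 + f3)) (by simp [f1, f2, f3])
  have h3 := hT ((f1 + f3).prod (f2 + f3)) (by simp [f1, f2, f3])
  have h4 := hT (f1.prod f2) (by simp [f1, f2])
  have e1 : (L.comp ((f1 + f3).prod f2)).comp (.inr ℝ (E × E) E) = L.comp (.inl ℝ E E) := by
    ext; simp [f1, f2, f3]
  have e2 : (L.comp (f1.prod (f2 + f3))).comp (.inr ℝ (E × E) E) = L.comp (.inr ℝ E E) := by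
    ext; simp [f1, f2, f3]
  have e3 : (L.comp ((f1 + f3).prod (f2 + f3))).comp (.inr ℝ (E × E) E)
      = L.comp (.inl ℝ E E) + L.comp (.inr ℝ E E) := by
    ext; simp [f1, f2, f3, ← map_add]
  have e4 : (L.comp (f1.prod f2)).comp (.inr ℝ (E × E) E) = 0 := by
    ext
    simp only [f1, f2]
    exact map_zero L
  have h5 := charFunDual_map (μ := shiftedCompoundPoisson a ν)
    ((ContinuousLinearMap.id ℝ E).prod (ContinuousLinearMap.id ℝ E)) L
  have e5 : L.comp ((ContinuousLinearMap.id ℝ E).prod (ContinuousLinearMap.id ℝ E))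
      = L.comp (.inl ℝ E E) + L.comp (.inr ℝ E E) := by
    ext; simp [← map_add]
  rw [e1] at h1
  rw [e2] at h2
  rw [e3] at h3
  rw [e4, charFunDual_zero_eq_measureReal] at h4
  rw [e5] at h5
  rw [hadd, hadd, hadd, hadd, charFunDual_prod]
  have key := charFunDual_covCoupling_mul a ν L
  refine (congrArg₂ _ h5 (congrArg₂ _ h1 h2)).trans (Eq.trans ?_
    (congrArg₂ _ rfl (congrArg₂ _ h3 h4)).symm)
  linear_combination (-1 : ℂ) * key

/-- The covariance representation
`Cov(f, g) = ∫ (f(U + u) - f(U)) (g(V + u) - g(V)) d(Π ⊗ ν)` for functions with enough moments. -/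
lemma integral_mul_sub_eq_integral_covCoupling [CompleteSpace E] (a : E) (ν : Measure E)
    [IsFiniteMeasure ν] {f g : E → ℝ} (hf : Measurable f) (hg : Measurable g)
    (hfg : Integrable (fun x => f x * g x) (shiftedCompoundPoisson a ν))
    (hf1 : Integrable f (shiftedCompoundPoisson a ν))
    (hg1 : Integrable g (shiftedCompoundPoisson a ν))
    (h1 : Integrable (fun p => f (p.1.1 + p.2) * g p.1.2) ((covCoupling a ν).prod ν))
    (h2 : Integrable (fun p => f p.1.1 * g (p.1.2 + p.2)) ((covCoupling a ν).prod ν))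
    (h3 : Integrable (fun p => f (p.1.1 + p.2) * g (p.1.2 + p.2)) ((covCoupling a ν).prod ν))
    (h4 : Integrable (fun p => f p.1.1 * g p.1.2) ((covCoupling a ν).prod ν)) :
    ∫ x, f x * g x ∂(shiftedCompoundPoisson a ν)
        - (∫ x, f x ∂(shiftedCompoundPoisson a ν)) * ∫ x, g x ∂(shiftedCompoundPoisson a ν) =
      ∫ p, (f (p.1.1 + p.2) - f p.1.1) * (g (p.1.2 + p.2) - g p.1.2)
        ∂((covCoupling a ν).prod ν) := by
  have hm' : ∀ m : Measure (E × E), AEStronglyMeasurable (fun q : E × E => f q.1 * g q.2) m :=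
    fun m => Measurable.aestronglyMeasurable (by fun_prop)
  have key := congrArg (fun m => ∫ q, f q.1 * g q.2 ∂m) (map_covCoupling_add_eq a ν)
  beta_reduce at key
  have i0 := (integrable_map_measure (f := fun x : E => (x, x)) (hm' _) (by fun_prop)).2 hfg
  have i1 := (integrable_map_measure (f := fun p : (E × E) × E => (p.1.1 + p.2, p.1.2))
    (hm' _) (by fun_prop)).2 h1
  have i2 := (integrable_map_measure (f := fun p : (E × E) × E => (p.1.1, p.1.2 + p.2))
    (hm' _) (by fun_prop)).2 h2
  have i3 := (integrable_map_measure (f := fun p : (E × E) × E => (p.1.1 + p.2, p.1.2 + p.2))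
    (hm' _) (by fun_prop)).2 h3
  have i4 := (integrable_map_measure (f := fun p : (E × E) × E => p.1) (hm' _) (by fun_prop)).2 h4
  rw [integral_add_measure i0 (i1.add_measure i2), integral_add_measure i1 i2,
    integral_add_measure (hf1.mul_prod hg1) (i3.add_measure i4), integral_add_measure i3 i4,
    integral_map (by fun_prop) (hm' _), integral_map (by fun_prop) (hm' _),
    integral_map (by fun_prop) (hm' _), integral_map (by fun_prop) (hm' _),
    integral_map (by fun_prop) (hm' _), integral_prod_mul] at key
  have e : (fun p : (E × E) × E => (f (p.1.1 + p.2) - f p.1.1) * (g (p.1.2 + p.2) - g p.1.2)) =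
      fun p => (f (p.1.1 + p.2) * g (p.1.2 + p.2) + f p.1.1 * g p.1.2)
        - (f (p.1.1 + p.2) * g p.1.2 + f p.1.1 * g (p.1.2 + p.2)) := by
    ext p; ring
  dsimp only at key
  rw [e]
  refine Eq.trans ?_ (integral_sub (h3.add h4) (h1.add h2)).symm
  rw [integral_add' h3 h4, integral_add' h1 h2]
  linarith

variable {ν : Measure E} [IsFiniteMeasure ν] {t c : ℝ}

lemma integrable_norm_mul_exp_norm_covCoupling [CompleteSpace E] (a : E) (ht : 0 ≤ t) (htc : t < c)
    (hν : Integrable (fun u => Real.exp (c * ‖u‖)) ν) {φ ψ : (E × E) × E → E}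
    (hφm : Measurable φ) (hψm : Measurable ψ)
    (hφ : ∀ p, ‖φ p‖ ≤ ‖p.1.1‖ + ‖p.2‖) (hψ : ∀ p, ‖ψ p‖ ≤ ‖p.1.2‖ + ‖p.2‖) :
    Integrable (fun p => ‖φ p‖ * Real.exp (t * ‖ψ p‖)) ((covCoupling a ν).prod ν) := by
  have h := integrable_exp_norm_shiftedCompoundPoisson a ν (ht.trans htc.le) hν
  have h1 : Integrable (fun p : E × E => Real.exp (c * ‖p.1‖)) (covCoupling a ν) := by
    rw [← map_fst_covCoupling] at h
    exact h.comp_measurable measurable_fst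
  have h2 : Integrable (fun p : E × E => Real.exp (c * ‖p.2‖)) (covCoupling a ν) := by
    have h := integrable_exp_norm_shiftedCompoundPoisson a ν (ht.trans htc.le) hν
    rw [← map_snd_covCoupling] at h
    exact h.comp_measurable measurable_snd
  refine (((h1.add h2).mul_prod hν).const_mul (c - t)⁻¹).mono' (by fun_prop)
    (ae_of_all _ fun p => ?_)
  rw [Real.norm_of_nonneg (by positivity)]
  exact norm_mul_exp_norm_le ht htc (hφ p) (hψ p)

/-- The integrand of the covariance representation for the pair `‖·‖`, `e ^ (t ‖·‖)`. -/
noncomputable def covIntegrand (t : ℝ) (p : (E × E) × E) : ℝ :=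
  (‖p.1.1 + p.2‖ - ‖p.1.1‖) * (Real.exp (t * ‖p.1.2 + p.2‖) - Real.exp (t * ‖p.1.2‖))

lemma integrable_covIntegrand [CompleteSpace E] (a : E) (ht : 0 ≤ t) (htc : t < c)
    (hν : Integrable (fun u => Real.exp (c * ‖u‖)) ν) :
    Integrable (covIntegrand t) ((covCoupling a ν).prod ν) := by
  have h1 := integrable_norm_mul_exp_norm_covCoupling a ht htc hν
    (φ := fun p => p.1.1 + p.2) (ψ := fun p => p.1.2) (by fun_prop) (by fun_prop)
    (fun p => norm_add_le _ _) (fun p => by simp)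
  have h2 := integrable_norm_mul_exp_norm_covCoupling a ht htc hν
    (φ := fun p => p.1.1) (ψ := fun p => p.1.2 + p.2) (by fun_prop) (by fun_prop)
    (fun p => by simp) (fun p => norm_add_le _ _)
  have h3 := integrable_norm_mul_exp_norm_covCoupling a ht htc hν
    (φ := fun p => p.1.1 + p.2) (ψ := fun p => p.1.2 + p.2) (by fun_prop) (by fun_prop)
    (fun p => norm_add_le _ _) (fun p => norm_add_le _ _)
  have h4 := integrable_norm_mul_exp_norm_covCoupling a ht htc hν
    (φ := fun p => p.1.1) (ψ := fun p => p.1.2) (by fun_prop) (by fun_prop)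
    (fun p => by simp) (fun p => by simp)
  refine ((h3.add h4).sub (h1.add h2)).congr (ae_of_all _ fun p => ?_)
  simp only [covIntegrand, Pi.add_apply, Pi.sub_apply]
  ring

lemma cov_norm_exp_norm_eq [CompleteSpace E] (a : E) (ht : 0 ≤ t) (htc : t < c)
    (hν : Integrable (fun u => Real.exp (c * ‖u‖)) ν) :
    ∫ x, ‖x‖ * Real.exp (t * ‖x‖) ∂(shiftedCompoundPoisson a ν)
        - (∫ x, ‖x‖ ∂(shiftedCompoundPoisson a ν))
          * ∫ x, Real.exp (t * ‖x‖) ∂(shiftedCompoundPoisson a ν) =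
      ∫ p, covIntegrand t p ∂((covCoupling a ν).prod ν) := by
  refine integral_mul_sub_eq_integral_covCoupling a ν (f := fun x => ‖x‖)
    (g := fun x => Real.exp (t * ‖x‖)) (by fun_prop) (by fun_prop)
    (integrable_norm_mul_exp_norm_shiftedCompoundPoisson a ht htc hν) ?_ ?_ ?_ ?_ ?_ ?_
  · simpa using integrable_norm_mul_exp_norm_shiftedCompoundPoisson a le_rfl (ht.trans_lt htc) hν
  · refine integrable_exp_norm_shiftedCompoundPoisson a ν ht
      (hν.mono' (by fun_prop) (ae_of_all _ fun u => ?_))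
    rw [Real.norm_eq_abs, Real.abs_exp]
    gcongr
  · exact integrable_norm_mul_exp_norm_covCoupling a ht htc hν (by fun_prop) (by fun_prop)
      (fun p => norm_add_le _ _) (fun p => by simp)
  · exact integrable_norm_mul_exp_norm_covCoupling a ht htc hν (by fun_prop) (by fun_prop)
      (fun p => by simp) (fun p => norm_add_le _ _)
  · exact integrable_norm_mul_exp_norm_covCoupling a ht htc hν (by fun_prop) (by fun_prop)
      (fun p => norm_add_le _ _) (fun p => norm_add_le _ _)
  · exact integrable_norm_mul_exp_norm_covCoupling a ht htc hν (by fun_prop) (by fun_prop)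
      (fun p => by simp) (fun p => by simp)

end Covariance

/-! ### The covariance inequality -/

section AxesMeasure

variable {d : ℕ} {ρ : Measure ℝ}

lemma measurable_euclideanSpace_single (k : Fin d) :
    Measurable (fun x : ℝ => EuclideanSpace.single k x) :=
  ((PiLp.continuous_toLp 2 _).comp (continuous_single k)).measurable

instance [IsFiniteMeasure ρ] : IsFiniteMeasure (axesMeasure d ρ) := by
  unfold axesMeasure
  infer_instance

lemma integrable_axesMeasure_iff {G : Type*} [NormedAddCommGroup G]
    {f : EuclideanSpace ℝ (Fin d) → G} (hf : StronglyMeasurable f) :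
    Integrable f (axesMeasure d ρ) ↔
      ∀ k : Fin d, Integrable (fun x => f (EuclideanSpace.single k x)) ρ := by
  rw [axesMeasure, integrable_finsetSum_measure]
  simp only [Finset.mem_univ, true_implies]
  exact forall_congr' fun k => integrable_map_measure hf.aestronglyMeasurable
    (measurable_euclideanSpace_single k).aemeasurable

lemma integral_axesMeasure {f : EuclideanSpace ℝ (Fin d) → ℝ} (hf : StronglyMeasurable f)
    (hint : Integrable f (axesMeasure d ρ)) :
    ∫ u, f u ∂(axesMeasure d ρ) = ∑ k : Fin d, ∫ x, f (EuclideanSpace.single k x) ∂ρ := by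
  rw [axesMeasure, integral_finsetSum_measure]
  · exact Finset.sum_congr rfl fun k _ =>
      integral_map (measurable_euclideanSpace_single k).aemeasurable hf.aestronglyMeasurable
  · rwa [axesMeasure, integrable_finsetSum_measure] at hint

end AxesMeasure

section Pointwise

variable {d : ℕ}

lemma abs_norm_add_single_sub_norm_le (U : EuclideanSpace ℝ (Fin d)) (k : Fin d) (x : ℝ) :
    |‖U + EuclideanSpace.single k x‖ - ‖U‖| ≤ |x| := by
  refine (abs_norm_sub_norm_le _ _).trans ?_
  simp

lemma norm_add_single_sq (U : EuclideanSpace ℝ (Fin d)) (k : Fin d) (x : ℝ) :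
    ‖U + EuclideanSpace.single k x‖ ^ 2 = ‖U‖ ^ 2 + (2 * x * U k + x ^ 2) := by
  rw [norm_add_sq_real, EuclideanSpace.inner_single_right]
  simp
  ring

/-- Jumps along the axes change the norm by at most `|x|` each; outside a ball of radius of order
`√d`, the squares of these changes add up to a quantity which does not depend on the dimension. -/
lemma sum_sq_norm_add_single_sub_norm_le {l : ℝ} (hl : 0 < l) (U : EuclideanSpace ℝ (Fin d))
    (x : ℝ) :
    ∑ k : Fin d, (‖U + EuclideanSpace.single k x‖ - ‖U‖) ^ 2 ≤ 8 * x ^ 2 + 4 / l * x ^ 4 +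
      2 / l * x ^ 2 * {v : EuclideanSpace ℝ (Fin d) | ‖v‖ ^ 2 < l * d / 2}.indicator
        (fun _ => l * d / 2) U := by
  by_cases hU : ‖U‖ ^ 2 < l * d / 2
  · rw [Set.indicator_of_mem (by exact hU)]
    have h : ∑ k : Fin d, (‖U + EuclideanSpace.single k x‖ - ‖U‖) ^ 2 ≤ ∑ _k : Fin d, x ^ 2 :=
      Finset.sum_le_sum fun k _ => sq_le_sq.2 (abs_norm_add_single_sub_norm_le U k x)
    refine h.trans ?_
    have e : 2 / l * x ^ 2 * (l * d / 2) = d * x ^ 2 := by field_simp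
    rw [e]
    simp only [Finset.sum_const, Finset.card_univ, Fintype.card_fin, nsmul_eq_mul]
    have : 0 ≤ 8 * x ^ 2 + 4 / l * x ^ 4 := by positivity
    linarith
  · rw [Set.indicator_of_notMem (by exact hU), mul_zero, add_zero]
    rw [not_lt] at hU
    rcases Nat.eq_zero_or_pos d with hd | hd
    · subst hd
      simp only [Finset.univ_eq_empty, Finset.sum_empty]
      positivity
    have hd' : (0 : ℝ) < d := by exact_mod_cast hd
    have hU2 : 0 < ‖U‖ ^ 2 := lt_of_lt_of_le (by positivity) hU
    have hU0 : 0 < ‖U‖ := by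
      rcases (norm_nonneg U).eq_or_lt with h | h
      · rw [← h] at hU2; simp at hU2
      · exact h
    have h : ∀ k : Fin d, (‖U + EuclideanSpace.single k x‖ - ‖U‖) ^ 2 ≤
        (8 * x ^ 2 * U k ^ 2 + 2 * x ^ 4) / ‖U‖ ^ 2 := by
      intro k
      set b := ‖U + EuclideanSpace.single k x‖ with hb
      have hb0 : 0 ≤ b := norm_nonneg _
      have e : (b - ‖U‖) * (b + ‖U‖) = 2 * x * U k + x ^ 2 := by
        have := norm_add_single_sq U k x
        rw [← hb] at this
        linarith
      rw [le_div_iff₀ hU2]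
      calc (b - ‖U‖) ^ 2 * ‖U‖ ^ 2 ≤ (b - ‖U‖) ^ 2 * (b + ‖U‖) ^ 2 := by
            gcongr; linarith
        _ = (2 * x * U k + x ^ 2) ^ 2 := by rw [← e]; ring
        _ ≤ _ := by nlinarith [sq_nonneg (2 * x * U k - x ^ 2)]
    refine (Finset.sum_le_sum fun k _ => h k).trans ?_
    rw [← Finset.sum_div, Finset.sum_add_distrib, ← Finset.mul_sum, Finset.sum_const,
      ← EuclideanSpace.real_norm_sq_eq, div_le_iff₀ hU2]
    simp only [Finset.card_univ, Fintype.card_fin, nsmul_eq_mul]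
    have : d * (2 * x ^ 4) ≤ 4 / l * x ^ 4 * ‖U‖ ^ 2 := by
      calc d * (2 * x ^ 4) = 4 / l * x ^ 4 * (l * d / 2) := by field_simp; ring
        _ ≤ _ := by gcongr
    linarith

/-- Convexity of `exp` on `[0, t |x|]`. -/
lemma abs_exp_sub_one_mul_le {t s x : ℝ} (ht : 0 ≤ t) (hs : |s| ≤ |x|) :
    |x| * |Real.exp (t * s) - 1| ≤ |s| * (Real.exp (t * |x|) - 1) := by
  rcases eq_or_ne x 0 with rfl | hx
  · simp only [abs_zero, abs_nonpos_iff] at hs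
    simp [hs]
  have hx' : 0 < |x| := abs_pos.2 hx
  -- for `s < 0` the left side only grows when `s` is replaced by `|s|`
  have h1 : |Real.exp (t * s) - 1| ≤ Real.exp (t * |s|) - 1 := by
    rcases le_total 0 s with h | h
    · rw [abs_of_nonneg h, abs_of_nonneg]
      linarith [Real.one_le_exp (mul_nonneg ht h)]
    · rw [abs_of_nonpos h, abs_of_nonpos (sub_nonpos.2 (Real.exp_le_one_iff.2
        (mul_nonpos_of_nonneg_of_nonpos ht h)))]
      have h2 := Real.add_one_le_exp (t * s)
      have h3 := Real.add_one_le_exp (t * -s)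
      linarith
  have hw : 0 ≤ 1 - |s| / |x| := by rw [sub_nonneg, div_le_one hx']; exact hs
  have h2 := convexOn_exp.2 (Set.mem_univ (0 : ℝ)) (Set.mem_univ (t * |x|)) hw
    (div_nonneg (abs_nonneg s) (abs_nonneg x)) (sub_add_cancel _ _)
  have e : (1 - |s| / |x|) • (0 : ℝ) + (|s| / |x|) • (t * |x|) = t * |s| := by
    simp only [smul_eq_mul]; field_simp; ring
  rw [e] at h2
  simp only [smul_eq_mul, Real.exp_zero, mul_one] at h2
  calc |x| * |Real.exp (t * s) - 1| ≤ |x| * (Real.exp (t * |s|) - 1) := by gcongr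
    _ ≤ |x| * (1 - |s| / |x| + |s| / |x| * Real.exp (t * |x|) - 1) := by gcongr
    _ = _ := by field_simp; ring

/-- The weight that controls the covariance integrand after summing over the axes. -/
noncomputable def jumpWeight (t x : ℝ) : ℝ := |x| * (Real.exp (t * |x|) - 1)

lemma jumpWeight_nonneg {t : ℝ} (ht : 0 ≤ t) (x : ℝ) : 0 ≤ jumpWeight t x :=
  mul_nonneg (abs_nonneg x) (by linarith [Real.one_le_exp (mul_nonneg ht (abs_nonneg x))])

/-- By the arithmetic-geometric mean inequality the two increments of the norm decouple. -/
lemma sq_mul_covIntegrand_single_le {t : ℝ} (ht : 0 ≤ t)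
    (p : EuclideanSpace ℝ (Fin d) × EuclideanSpace ℝ (Fin d)) (k : Fin d) (x : ℝ) :
    x ^ 2 * covIntegrand t (p, EuclideanSpace.single k x) ≤
      Real.exp (t * ‖p.2‖) * jumpWeight t x *
        (((‖p.1 + EuclideanSpace.single k x‖ - ‖p.1‖) ^ 2
          + (‖p.2 + EuclideanSpace.single k x‖ - ‖p.2‖) ^ 2) / 2) := by
  set α := ‖p.1 + EuclideanSpace.single k x‖ - ‖p.1‖ with hα
  set β := ‖p.2 + EuclideanSpace.single k x‖ - ‖p.2‖ with hβ
  have hβx : |β| ≤ |x| := abs_norm_add_single_sub_norm_le p.2 k x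
  have e : Real.exp (t * ‖p.2 + EuclideanSpace.single k x‖) - Real.exp (t * ‖p.2‖)
      = Real.exp (t * ‖p.2‖) * (Real.exp (t * β) - 1) := by
    rw [mul_sub, ← Real.exp_add, hβ]; ring_nf
  have h1 := abs_exp_sub_one_mul_le ht hβx
  have h0 : 0 ≤ Real.exp (t * |x|) - 1 := by
    linarith [Real.one_le_exp (mul_nonneg ht (abs_nonneg x))]
  unfold covIntegrand
  dsimp only
  rw [e, ← hα]
  calc x ^ 2 * (α * (Real.exp (t * ‖p.2‖) * (Real.exp (t * β) - 1)))
      ≤ x ^ 2 * (|α| * (Real.exp (t * ‖p.2‖) * |Real.exp (t * β) - 1|)) := by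
        gcongr x ^ 2 * ?_
        refine (le_abs_self _).trans ?_
        rw [abs_mul, abs_mul, Real.abs_exp]
    _ = Real.exp (t * ‖p.2‖) * |x| * |α| * (|x| * |Real.exp (t * β) - 1|) := by
        rw [← sq_abs x]; ring
    _ ≤ Real.exp (t * ‖p.2‖) * |x| * |α| * (|β| * (Real.exp (t * |x|) - 1)) := by gcongr
    _ = Real.exp (t * ‖p.2‖) * jumpWeight t x * (|α| * |β|) := by rw [jumpWeight]; ring
    _ ≤ _ := by
        have := jumpWeight_nonneg ht x
        gcongr
        rw [← sq_abs α, ← sq_abs β]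
        nlinarith [sq_nonneg (|α| - |β|)]

/-- The cut-off function `(l d / 2) 1_{‖v‖ ² < l d / 2}`. On this ball the bound on the squared
increments is of order `d`; the height is chosen so that `e ^ cutoff` has a bounded expectation. -/
noncomputable def cutoff (d : ℕ) (l : ℝ) : EuclideanSpace ℝ (Fin d) → ℝ :=
  {v : EuclideanSpace ℝ (Fin d) | ‖v‖ ^ 2 < l * d / 2}.indicator (fun _ => l * d / 2)

lemma sum_covIntegrand_single_le {t l : ℝ} (ht : 0 ≤ t) (hl : 0 < l)
    (p : EuclideanSpace ℝ (Fin d) × EuclideanSpace ℝ (Fin d)) (x : ℝ) :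
    ∑ k : Fin d, covIntegrand t (p, EuclideanSpace.single k x) ≤
      Real.exp (t * ‖p.2‖) * jumpWeight t x *
        (8 + 4 / l * x ^ 2 + 1 / l * (cutoff d l p.1 + cutoff d l p.2)) := by
  rcases eq_or_ne x 0 with rfl | hx
  · have : ∀ k : Fin d, EuclideanSpace.single k (0 : ℝ) = 0 := fun k => by simp
    simp [covIntegrand, this, jumpWeight]
  have hx2 : 0 < x ^ 2 := by positivity
  refine le_of_mul_le_mul_left ?_ hx2
  rw [Finset.mul_sum]
  refine (Finset.sum_le_sum fun k _ => sq_mul_covIntegrand_single_le ht p k x).trans ?_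
  rw [← Finset.mul_sum, ← Finset.sum_div, Finset.sum_add_distrib]
  have h1 := sum_sq_norm_add_single_sub_norm_le hl p.1 x
  have h2 := sum_sq_norm_add_single_sub_norm_le hl p.2 x
  have h0 := mul_nonneg (Real.exp_pos (t * ‖p.2‖)).le (jumpWeight_nonneg ht x)
  calc _ ≤ Real.exp (t * ‖p.2‖) * jumpWeight t x *
        ((8 * x ^ 2 + 4 / l * x ^ 4 + 2 / l * x ^ 2 * cutoff d l p.1
          + (8 * x ^ 2 + 4 / l * x ^ 4 + 2 / l * x ^ 2 * cutoff d l p.2)) / 2) := by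
        gcongr
        · exact h1
        · exact h2
    _ = _ := by ring

end Pointwise

section Entropy

/-- The entropy (Gibbs variational) inequality for the density `e ^ (t F) / E e ^ (t F)`, with the
entropy of `e ^ (t F)` bounded by `t Cov(F, e ^ (t F))` through Jensen's inequality. -/
lemma integral_mul_exp_le {Ω : Type*} [MeasurableSpace Ω] {Q : Measure Ω} [IsProbabilityMeasure Q]
    {K F : Ω → ℝ} {t C : ℝ} (hC : 0 < C)
    (hF : Integrable F Q) (hG : Integrable (fun ω => Real.exp (t * F ω)) Q)
    (hFG : Integrable (fun ω => F ω * Real.exp (t * F ω)) Q)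
    (hKG : Integrable (fun ω => K ω * Real.exp (t * F ω)) Q)
    (hK : Integrable (fun ω => Real.exp (K ω)) Q) (hKC : ∫ ω, Real.exp (K ω) ∂Q ≤ C) :
    ∫ ω, K ω * Real.exp (t * F ω) ∂Q ≤ Real.log C * ∫ ω, Real.exp (t * F ω) ∂Q +
      t * (∫ ω, F ω * Real.exp (t * F ω) ∂Q - (∫ ω, F ω ∂Q) * ∫ ω, Real.exp (t * F ω) ∂Q) := by
  set m := ∫ ω, Real.exp (t * F ω) ∂Q with hm
  have hm0 : 0 < m := integral_exp_pos hG
  -- Jensen: `log m ≥ t E F`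
  have hJ : t * ∫ ω, F ω ∂Q ≤ Real.log m := by
    have h1 : ∫ ω, (t * F ω + (1 - Real.log m)) ∂Q ≤ ∫ ω, Real.exp (t * F ω - Real.log m) ∂Q := by
      refine integral_mono ((hF.const_mul t).add (integrable_const _)) ?_ fun ω => ?_
      · simp only [Real.exp_sub]; exact hG.div_const _
      · simp only; linarith [Real.add_one_le_exp (t * F ω - Real.log m)]
    simp only [Real.exp_sub] at h1
    rw [integral_div, Real.exp_log hm0, ← hm, div_self hm0.ne',
      integral_add (hF.const_mul t) (integrable_const _), integral_const_mul] at h1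
    simp at h1
    linarith
  -- `e ^ h (b - h + 1) ≤ e ^ b` with `h = t F - log m`, `b = K - log C`, multiplied by `m`
  have hY : ∀ ω, K ω * Real.exp (t * F ω) ≤
      t * (F ω * Real.exp (t * F ω)) + (Real.log C - Real.log m - 1) * Real.exp (t * F ω)
        + m / C * Real.exp (K ω) := by
    intro ω
    have h1 := Real.add_one_le_exp ((K ω - Real.log C) - (t * F ω - Real.log m))
    have h2 : Real.exp ((K ω - Real.log C) - (t * F ω - Real.log m)) * Real.exp (t * F ω)
        = m / C * Real.exp (K ω) := by
      rw [← Real.exp_add]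
      have : K ω - Real.log C - (t * F ω - Real.log m) + t * F ω
        = Real.log m - Real.log C + K ω := by ring
      rw [this, Real.exp_add, Real.exp_sub, Real.exp_log hm0, Real.exp_log hC]
    have h3 := mul_le_mul_of_nonneg_right h1 (Real.exp_pos (t * F ω)).le
    rw [h2] at h3
    linarith
  have h := integral_mono hKG (((hFG.const_mul t).add (hG.const_mul _)).add (hK.const_mul _)) hY
  rw [integral_add' ((hFG.const_mul t).add (hG.const_mul _)) (hK.const_mul _),
    integral_add' (hFG.const_mul t) (hG.const_mul _), integral_const_mul, integral_const_mul,
    integral_const_mul, ← hm] at h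
  have h4 : m / C * ∫ ω, Real.exp (K ω) ∂Q ≤ m := by
    calc m / C * ∫ ω, Real.exp (K ω) ∂Q ≤ m / C * C := by gcongr
      _ = m := by field_simp
  nlinarith [mul_le_mul_of_nonneg_right hJ hm0.le]

end Entropy

section FiniteCase

/-- Near the origin the integrand is of order `x ^ 2`, at infinity it is dominated by
`e ^ (c |x|)`. -/
lemma integrable_abs_pow_mul_exp_sub_one {ρ : Measure ℝ} {t c : ℝ} (ht : 0 ≤ t) (htc : t < c)
    (h1 : Integrable (fun x => min 1 (x ^ 2)) ρ)
    (h2 : IntegrableOn (fun x => Real.exp (c * |x|)) {x | 1 < |x|} ρ) (n : ℕ) :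
    Integrable (fun x => |x| ^ (n + 1) * (Real.exp (t * |x|) - 1)) ρ := by
  have hS : MeasurableSet {x : ℝ | 1 < |x|} := measurableSet_lt measurable_const (by fun_prop)
  have hε : 0 < c - t := sub_pos.2 htc
  refine ((h1.const_mul (Real.exp t - 1)).add ((h2.integrable_indicator hS).const_mul
    ((n + 1).factorial / (c - t) ^ (n + 1)))).mono' (by fun_prop) (ae_of_all _ fun x => ?_)
  have h0 : 0 ≤ Real.exp (t * |x|) - 1 := by
    linarith [Real.one_le_exp (mul_nonneg ht (abs_nonneg x))]
  have ht1 : 0 ≤ Real.exp t - 1 := by linarith [Real.one_le_exp ht]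
  rw [Real.norm_of_nonneg (by positivity)]
  simp only [Pi.add_apply]
  by_cases hx : 1 < |x|
  · rw [Set.indicator_of_mem (by exact hx)]
    have h3 := Real.pow_div_factorial_le_exp ((c - t) * |x|) (by positivity) (n + 1)
    have h4 : |x| ^ (n + 1) ≤ (n + 1).factorial / (c - t) ^ (n + 1)
        * Real.exp ((c - t) * |x|) := by
      rw [mul_pow, div_le_iff₀ (by positivity)] at h3
      rw [div_mul_eq_mul_div, le_div_iff₀ (by positivity)]
      linarith
    have h5 : 0 ≤ (Real.exp t - 1) * min 1 (x ^ 2) := by positivity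
    calc |x| ^ (n + 1) * (Real.exp (t * |x|) - 1)
        ≤ ((n + 1).factorial / (c - t) ^ (n + 1) * Real.exp ((c - t) * |x|))
            * Real.exp (t * |x|) := by
          gcongr
          linarith
      _ = (n + 1).factorial / (c - t) ^ (n + 1) * Real.exp (c * |x|) := by
          rw [mul_assoc, ← Real.exp_add]; congr 2; ring
      _ ≤ _ := by linarith
  · rw [Set.indicator_of_notMem (by exact hx), mul_zero, add_zero]
    rw [not_lt] at hx
    have h3 := abs_exp_sub_one_mul_le (t := t) (s := |x|) (x := 1) ht (by simpa using hx)
    rw [abs_one, one_mul, mul_one, abs_abs, abs_of_nonneg h0] at h3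
    have h4 : min 1 (x ^ 2) = |x| * |x| := by
      rw [min_eq_right (by rw [← sq_abs]; exact pow_le_one₀ (abs_nonneg x) hx), ← sq_abs, sq]
    rw [h4]
    calc |x| ^ (n + 1) * (Real.exp (t * |x|) - 1)
        ≤ |x| * (|x| * (Real.exp t - 1)) := by
          gcongr
          exact pow_le_of_le_one (abs_nonneg x) hx (by omega)
      _ = _ := by ring

variable {d : ℕ} {ρ : Measure ℝ} {t c l : ℝ}

lemma measurable_cutoff (d : ℕ) (l : ℝ) : Measurable (cutoff d l) :=
  measurable_const.indicator (measurableSet_lt (by fun_prop) measurable_const)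

lemma cutoff_nonneg (hl : 0 < l) (v : EuclideanSpace ℝ (Fin d)) : 0 ≤ cutoff d l v :=
  Set.indicator_nonneg (fun _ _ => by positivity) v

lemma cutoff_le (hl : 0 < l) (v : EuclideanSpace ℝ (Fin d)) : cutoff d l v ≤ l * d / 2 :=
  Set.indicator_le_self' (fun _ _ => by positivity) v

lemma integrable_exp_cutoff {μ : Measure (EuclideanSpace ℝ (Fin d))} [IsProbabilityMeasure μ]
    (hl : 0 < l) : Integrable (fun v => Real.exp (cutoff d l v)) μ := by
  refine (integrable_const (Real.exp (l * d / 2))).mono'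
    (measurable_cutoff d l).exp.aestronglyMeasurable (ae_of_all _ fun v => ?_)
  rw [Real.norm_eq_abs, Real.abs_exp]
  exact Real.exp_le_exp.2 (cutoff_le hl v)

/-- Chernoff bound for the event that `‖v‖` is small. -/
lemma integral_exp_cutoff_le {μ : Measure (EuclideanSpace ℝ (Fin d))} [IsProbabilityMeasure μ]
    (hl : 0 < l) (hμ : ∫ v, Real.exp (-‖v‖ ^ 2) ∂μ ≤ 2 * Real.exp (-(l * d))) :
    ∫ v, Real.exp (cutoff d l v) ∂μ ≤ 3 := by
  have hi : Integrable (fun v : EuclideanSpace ℝ (Fin d) => Real.exp (-‖v‖ ^ 2)) μ := by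
    refine (integrable_const (1 : ℝ)).mono' (by fun_prop) (ae_of_all _ fun v => ?_)
    rw [Real.norm_eq_abs, Real.abs_exp, Real.exp_le_one_iff]
    nlinarith [sq_nonneg ‖v‖]
  have h : ∀ v : EuclideanSpace ℝ (Fin d),
      Real.exp (cutoff d l v) ≤ 1 + Real.exp (l * d) * Real.exp (-‖v‖ ^ 2) := by
    intro v
    rw [← Real.exp_add]
    by_cases hv : ‖v‖ ^ 2 < l * d / 2
    · rw [cutoff, Set.indicator_of_mem (by exact hv)]
      have : Real.exp (l * d / 2) ≤ Real.exp (l * d + -‖v‖ ^ 2) := by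
        apply Real.exp_le_exp.2; linarith
      linarith
    · rw [cutoff, Set.indicator_of_notMem (by exact hv), Real.exp_zero]
      linarith [Real.exp_pos (l * d + -‖v‖ ^ 2)]
  calc ∫ v, Real.exp (cutoff d l v) ∂μ
      ≤ ∫ v, (1 + Real.exp (l * d) * Real.exp (-‖v‖ ^ 2)) ∂μ :=
        integral_mono (integrable_exp_cutoff hl) ((integrable_const _).add (hi.const_mul _)) h
    _ = 1 + Real.exp (l * d) * ∫ v, Real.exp (-‖v‖ ^ 2) ∂μ := by
        rw [integral_add (integrable_const _) (hi.const_mul _), integral_const_mul]; simp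
    _ ≤ 1 + Real.exp (l * d) * (2 * Real.exp (-(l * d))) := by gcongr
    _ = 3 := by
        have : Real.exp (l * d) * Real.exp (-(l * d)) = 1 := by rw [← Real.exp_add]; simp
        linear_combination 2 * this

lemma integrable_exp_norm_axesMeasure (h : Integrable (fun x => Real.exp (c * |x|)) ρ) :
    Integrable (fun u => Real.exp (c * ‖u‖)) (axesMeasure d ρ) := by
  rw [integrable_axesMeasure_iff (Measurable.stronglyMeasurable (by fun_prop))]
  intro k
  simpa using h

variable [IsFiniteMeasure ρ]

/-- The covariance of `‖·‖` and `e ^ (t ‖·‖)`, when the Lévy measure is finite. -/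
lemma cov_norm_exp_norm_le_add (a : EuclideanSpace ℝ (Fin d)) (ht : 0 ≤ t) (htc : t < c)
    (hl : 0 < l) (hρ : Integrable (fun x => Real.exp (c * |x|)) ρ)
    (hμ : ∫ v, Real.exp (-‖v‖ ^ 2) ∂(shiftedCompoundPoisson a (axesMeasure d ρ))
      ≤ 2 * Real.exp (-(l * d))) {m C : ℝ}
    (hm : m = ∫ x, Real.exp (t * ‖x‖) ∂(shiftedCompoundPoisson a (axesMeasure d ρ)))
    (hC : C = ∫ x, ‖x‖ * Real.exp (t * ‖x‖) ∂(shiftedCompoundPoisson a (axesMeasure d ρ))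
      - (∫ x, ‖x‖ ∂(shiftedCompoundPoisson a (axesMeasure d ρ))) * m) :
    C ≤ (8 * m + 2 / l * (Real.log 3 * m + t * C)) *
        (∫ x, |x| * (Real.exp (t * |x|) - 1) ∂ρ)
      + 4 / l * m * ∫ x, |x| ^ 3 * (Real.exp (t * |x|) - 1) ∂ρ := by
  set ν := axesMeasure d ρ
  set μ := shiftedCompoundPoisson a ν
  set Q := covCoupling a ν
  have hνc : Integrable (fun u => Real.exp (c * ‖u‖)) ν := integrable_exp_norm_axesMeasure hρ
  have hmin : Integrable (fun x : ℝ => min 1 (x ^ 2)) ρ :=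
    (integrable_const (1 : ℝ)).mono' (by fun_prop) (ae_of_all _ fun x => by
      rw [Real.norm_of_nonneg (by positivity)]; exact min_le_left _ _)
  have hJ1 : Integrable (fun x => |x| * (Real.exp (t * |x|) - 1)) ρ := by
    simpa using integrable_abs_pow_mul_exp_sub_one ht htc hmin hρ.integrableOn 0
  have hJ3 : Integrable (fun x => |x| ^ 3 * (Real.exp (t * |x|) - 1)) ρ :=
    integrable_abs_pow_mul_exp_sub_one ht htc hmin hρ.integrableOn 2
  set J1 := ∫ x, |x| * (Real.exp (t * |x|) - 1) ∂ρ
  set J3 := ∫ x, |x| ^ 3 * (Real.exp (t * |x|) - 1) ∂ρ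
  have h1 : Q.map Prod.fst = μ := map_fst_covCoupling a ν
  have h2 : Q.map Prod.snd = μ := map_snd_covCoupling a ν
  have hG : Integrable (fun x => Real.exp (t * ‖x‖)) μ :=
    (integrable_exp_norm_shiftedCompoundPoisson a ν (ht.trans htc.le) hνc).mono' (by fun_prop)
      (ae_of_all _ fun u => by rw [Real.norm_eq_abs, Real.abs_exp]; gcongr)
  have hFG : Integrable (fun x => ‖x‖ * Real.exp (t * ‖x‖)) μ :=
    integrable_norm_mul_exp_norm_shiftedCompoundPoisson a ht htc hνc
  have hF : Integrable (fun x => ‖x‖) μ := by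
    simpa using integrable_norm_mul_exp_norm_shiftedCompoundPoisson a le_rfl (ht.trans_lt htc) hνc
  have hexpK : ∫ v, Real.exp (cutoff d l v) ∂μ ≤ 3 := integral_exp_cutoff_le hl hμ
  have hKm := measurable_cutoff d l
  -- transfer to the coupling
  have tr2 : ∀ f : EuclideanSpace ℝ (Fin d) → ℝ, Measurable f → ∫ p, f p.2 ∂Q = ∫ x, f x ∂μ := by
    intro f hf
    rw [← h2, integral_map (by fun_prop) hf.aestronglyMeasurable]
  have tr1 : ∀ f : EuclideanSpace ℝ (Fin d) → ℝ, Measurable f → ∫ p, f p.1 ∂Q = ∫ x, f x ∂μ := by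
    intro f hf
    rw [← h1, integral_map (by fun_prop) hf.aestronglyMeasurable]
  have hG2 : Integrable (fun p => Real.exp (t * ‖p.2‖)) Q := by
    rw [← h2] at hG; exact hG.comp_measurable measurable_snd
  have hF2 : Integrable (fun p => ‖p.2‖) Q := by
    rw [← h2] at hF; exact hF.comp_measurable measurable_snd
  have hFG2 : Integrable (fun p => ‖p.2‖ * Real.exp (t * ‖p.2‖)) Q := by
    rw [← h2] at hFG; exact hFG.comp_measurable measurable_snd
  have hbd : ∀ φ : EuclideanSpace ℝ (Fin d) × EuclideanSpace ℝ (Fin d) → EuclideanSpace ℝ (Fin d),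
      Measurable φ → Integrable (fun p => cutoff d l (φ p) * Real.exp (t * ‖p.2‖)) Q := by
    intro φ hφ
    refine hG2.bdd_mul (hKm.comp hφ).aestronglyMeasurable
      (ae_of_all _ fun p => ?_) (c := l * d / 2)
    rw [Real.norm_of_nonneg (cutoff_nonneg hl _)]
    exact cutoff_le hl _
  have hent : ∀ φ : EuclideanSpace ℝ (Fin d) × EuclideanSpace ℝ (Fin d) → EuclideanSpace ℝ (Fin d),
      Measurable φ → (∫ p, Real.exp (cutoff d l (φ p)) ∂Q = ∫ v, Real.exp (cutoff d l v) ∂μ) →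
      Integrable (fun p => Real.exp (cutoff d l (φ p))) Q →
      ∫ p, cutoff d l (φ p) * Real.exp (t * ‖p.2‖) ∂Q ≤ Real.log 3 * m + t * C := by
    intro φ hφ hφμ hφi
    have h := integral_mul_exp_le (Q := Q) (K := fun p => cutoff d l (φ p)) (F := fun p => ‖p.2‖)
      (t := t) (C := 3) (by norm_num) hF2 hG2 hFG2 (hbd φ hφ) hφi (by rw [hφμ]; exact hexpK)
    rw [tr2 (fun x => Real.exp (t * ‖x‖)) (by fun_prop), tr2 (fun x => ‖x‖) (by fun_prop),
      tr2 (fun x => ‖x‖ * Real.exp (t * ‖x‖)) (by fun_prop), ← hm, ← hC] at h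
    exact h
  have hK : Integrable (fun v => Real.exp (cutoff d l v)) μ := integrable_exp_cutoff hl
  have hK1 := hent Prod.fst measurable_fst (tr1 _ hKm.exp) (by
    rw [← h1] at hK; exact hK.comp_measurable measurable_fst)
  have hK2 := hent Prod.snd measurable_snd (tr2 _ hKm.exp) (by
    rw [← h2] at hK; exact hK.comp_measurable measurable_snd)
  -- the covariance representation, with the sum over the axes under the integral
  have hD := integrable_covIntegrand a ht htc hνc
  have hDm : Measurable (covIntegrand (E := EuclideanSpace ℝ (Fin d)) t) := by
    unfold covIntegrand; fun_prop
  have hrep : C = ∫ p, ∫ u, covIntegrand t (p, u) ∂ν ∂Q := by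
    rw [hC, hm, cov_norm_exp_norm_eq a ht htc hνc, integral_prod _ hD]
  have hbound : ∀ᵐ p ∂Q, ∫ u, covIntegrand t (p, u) ∂ν ≤
      8 * J1 * Real.exp (t * ‖p.2‖) + 4 / l * J3 * Real.exp (t * ‖p.2‖)
        + 1 / l * J1 * (cutoff d l p.1 * Real.exp (t * ‖p.2‖)
          + cutoff d l p.2 * Real.exp (t * ‖p.2‖)) := by
    filter_upwards [hD.prod_right_ae] with p hp
    have hsm : StronglyMeasurable fun u => covIntegrand t (p, u) :=
      (hDm.comp measurable_prodMk_left).stronglyMeasurable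
    rw [integral_axesMeasure hsm hp, ← integral_finsetSum _
      fun k _ => (integrable_axesMeasure_iff hsm).1 hp k]
    have e : ∀ x, Real.exp (t * ‖p.2‖) * jumpWeight t x *
        (8 + 4 / l * x ^ 2 + 1 / l * (cutoff d l p.1 + cutoff d l p.2)) =
        Real.exp (t * ‖p.2‖) * (8 + 1 / l * (cutoff d l p.1 + cutoff d l p.2))
          * (|x| * (Real.exp (t * |x|) - 1)) +
        Real.exp (t * ‖p.2‖) * (4 / l) * (|x| ^ 3 * (Real.exp (t * |x|) - 1)) := by
      intro x
      rw [jumpWeight, ← sq_abs x]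
      ring
    refine (integral_mono (integrable_finsetSum _ fun k _ =>
      (integrable_axesMeasure_iff hsm).1 hp k)
      ((hJ1.const_mul _).add (hJ3.const_mul _))
      (fun x => (sum_covIntegrand_single_le ht hl p x).trans_eq (e x))).trans_eq ?_
    rw [integral_add' (hJ1.const_mul _) (hJ3.const_mul _), integral_const_mul, integral_const_mul]
    ring
  have hI1 := hG2.const_mul (8 * J1)
  have hI2 := hG2.const_mul (4 / l * J3)
  have hI3 := ((hbd Prod.fst measurable_fst).add (hbd Prod.snd measurable_snd)).const_mul
    (1 / l * J1)
  have hfin := integral_mono_ae hD.integral_prod_left ((hI1.add hI2).add hI3) hbound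
  rw [integral_add' (hI1.add hI2) hI3, integral_add' hI1 hI2, integral_const_mul,
    integral_const_mul, integral_const_mul,
    integral_add' (hbd Prod.fst measurable_fst) (hbd Prod.snd measurable_snd),
    tr2 (fun x => Real.exp (t * ‖x‖)) (by fun_prop), ← hm, ← hrep] at hfin
  have hJ1n : 0 ≤ J1 := integral_nonneg fun x => jumpWeight_nonneg ht x
  have : 1 / l * J1 * (∫ p, cutoff d l p.1 * Real.exp (t * ‖p.2‖) ∂Q +
      ∫ p, cutoff d l p.2 * Real.exp (t * ‖p.2‖) ∂Q) ≤
      1 / l * J1 * ((Real.log 3 * m + t * C) + (Real.log 3 * m + t * C)) := by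
    gcongr
  calc C ≤ _ := hfin
    _ ≤ 8 * J1 * m + 4 / l * J3 * m
        + 1 / l * J1 * ((Real.log 3 * m + t * C) + (Real.log 3 * m + t * C)) := by linarith
    _ = _ := by ring

/-- When `t g ≤ 1 / 2`, the covariance on the right of `cov_norm_exp_norm_le_add` is absorbed on the
left. -/
lemma cov_norm_exp_norm_le (a : EuclideanSpace ℝ (Fin d)) (ht : 0 ≤ t) (htc : t < c)
    (hl : 0 < l) (hρ : Integrable (fun x => Real.exp (c * |x|)) ρ)
    (hμ : ∫ v, Real.exp (-‖v‖ ^ 2) ∂(shiftedCompoundPoisson a (axesMeasure d ρ))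
      ≤ 2 * Real.exp (-(l * d))) {g : ℝ} (hg : rateFun ρ l t ≤ g) (htg : t * g ≤ 1 / 2) :
    ∫ x, ‖x‖ * Real.exp (t * ‖x‖) ∂(shiftedCompoundPoisson a (axesMeasure d ρ))
      - (∫ x, ‖x‖ ∂(shiftedCompoundPoisson a (axesMeasure d ρ)))
        * ∫ x, Real.exp (t * ‖x‖) ∂(shiftedCompoundPoisson a (axesMeasure d ρ)) ≤
    2 * g * ∫ x, Real.exp (t * ‖x‖) ∂(shiftedCompoundPoisson a (axesMeasure d ρ)) := by
  have key := cov_norm_exp_norm_le_add a ht htc hl hρ hμ rfl rfl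
  set m := ∫ x, Real.exp (t * ‖x‖) ∂(shiftedCompoundPoisson a (axesMeasure d ρ))
  set C := ∫ x, ‖x‖ * Real.exp (t * ‖x‖) ∂(shiftedCompoundPoisson a (axesMeasure d ρ))
      - (∫ x, ‖x‖ ∂(shiftedCompoundPoisson a (axesMeasure d ρ))) * m
  have hm : 0 ≤ m := integral_nonneg fun x => by positivity
  rw [rateFun] at hg
  have hJ1 : 0 ≤ ∫ x, |x| * (Real.exp (t * |x|) - 1) ∂ρ :=
    integral_nonneg fun x => jumpWeight_nonneg ht x
  have hJ3 : 0 ≤ ∫ x, |x| ^ 3 * (Real.exp (t * |x|) - 1) ∂ρ := by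
    refine integral_nonneg fun x => mul_nonneg (by positivity) ?_
    linarith [Real.one_le_exp (mul_nonneg ht (abs_nonneg x))]
  set J1 := ∫ x, |x| * (Real.exp (t * |x|) - 1) ∂ρ
  set J3 := ∫ x, |x| ^ 3 * (Real.exp (t * |x|) - 1) ∂ρ
  have hlog3 : Real.log 3 ≤ 2 * Real.log 2 := by
    have h : Real.log 3 ≤ Real.log 4 := Real.log_le_log (by norm_num) (by norm_num)
    have e : Real.log 4 = 2 * Real.log 2 := by
      rw [show (4 : ℝ) = 2 ^ 2 by norm_num, Real.log_pow]; norm_num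
    linarith
  have hlog2 : 1 / 2 < Real.log 2 := by linarith [Real.log_two_gt_d9]
  have hJ1l : 0 ≤ J1 / l := by positivity
  have hJ3l : 0 ≤ J3 / l := by positivity
  have hg' : 8 * J1 + 12 * Real.log 2 * (J1 / l) + 8 * (J3 / l) ≤ g := by
    refine le_trans (le_of_eq ?_) hg; ring
  have hc0 : 8 * J1 + 2 * Real.log 3 * (J1 / l) + 4 * (J3 / l) ≤ g := by nlinarith
  have hc1 : 2 * (J1 / l) ≤ g := by nlinarith
  have hkey : C ≤ (8 * J1 + 2 * Real.log 3 * (J1 / l) + 4 * (J3 / l)) * m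
      + t * (2 * (J1 / l)) * C := by
    refine key.trans (le_of_eq ?_); ring
  have hg0 : 0 ≤ g := le_trans (by positivity) hc1
  rcases le_total C 0 with hC | hC
  · exact hC.trans (by positivity)
  · have h1 : t * (2 * (J1 / l)) * C ≤ 1 / 2 * C := by
      gcongr
      exact le_trans (by gcongr) htg
    have h2 := mul_le_mul_of_nonneg_right hc0 hm
    linarith

end FiniteCase

/-! ### Integration of the differential inequality for the log-Laplace transform -/

section LogLaplace

variable {d : ℕ} {ρ : Measure ℝ} [IsFiniteMeasure ρ] {t c l : ℝ}

/-- The covariance inequality says that `(log E e ^ (s ‖X‖))' ≤ E ‖X‖ + 2 g(s)`. -/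
lemma integral_exp_norm_le (a : EuclideanSpace ℝ (Fin d)) (ht : 0 ≤ t) (htc : t < c)
    (hl : 0 < l) (hρ : Integrable (fun x => Real.exp (c * |x|)) ρ)
    (hμ : ∫ v, Real.exp (-‖v‖ ^ 2) ∂(shiftedCompoundPoisson a (axesMeasure d ρ))
      ≤ 2 * Real.exp (-(l * d))) {g : ℝ → ℝ}
    (hgi : IntervalIntegrable (fun s => 2 * g s) volume 0 t)
    (hg : ∀ s, 0 < s → s < t → rateFun ρ l s ≤ g s)
    (htg : ∀ s, 0 < s → s < t → s * g s ≤ 1 / 2) :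
    ∫ x, Real.exp (t * ‖x‖) ∂(shiftedCompoundPoisson a (axesMeasure d ρ)) ≤
      Real.exp (t * ∫ x, ‖x‖ ∂(shiftedCompoundPoisson a (axesMeasure d ρ))
        + ∫ s in (0 : ℝ)..t, 2 * g s) := by
  set μ := shiftedCompoundPoisson a (axesMeasure d ρ)
  set F : EuclideanSpace ℝ (Fin d) → ℝ := fun x => ‖x‖ with hF
  have hexp : ∀ s, s ≤ c → Integrable (fun x => Real.exp (s * F x)) μ := fun s hs =>
    (integrable_exp_norm_shiftedCompoundPoisson a _ (ht.trans htc.le)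
      (integrable_exp_norm_axesMeasure hρ)).mono' (by fun_prop) (ae_of_all _ fun u => by
        rw [Real.norm_eq_abs, Real.abs_exp]; simp only [hF]; gcongr)
  have hint : ∀ s, s < c → s ∈ interior (integrableExpSet F μ) := by
    intro s hs
    rw [mem_interior]
    exact ⟨Set.Iio c, fun r hr => hexp r (le_of_lt hr), isOpen_Iio, hs⟩
  have hderiv : ∀ s, s < c → HasDerivAt (fun s => Real.log (mgf F μ s) - s * ∫ x, F x ∂μ)
      ((∫ x, F x * Real.exp (s * F x) ∂μ) / mgf F μ s - ∫ x, F x ∂μ) s := by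
    intro s hs
    have h1 := (hasDerivAt_mgf (hint s hs)).log (mgf_pos (hexp s hs.le)).ne'
    have h2 := (hasDerivAt_id s).mul_const (∫ x, F x ∂μ)
    simp only [one_mul] at h2
    exact h1.sub h2
  have h := intervalIntegral.sub_le_integral_of_hasDeriv_right_of_le ht
    (g := fun s => Real.log (mgf F μ s) - s * ∫ x, F x ∂μ) (φ := fun s => 2 * g s)
    (fun s hs => (hderiv s (hs.2.trans_lt htc)).continuousAt.continuousWithinAt)
    (fun s hs => (hderiv s (hs.2.trans htc)).hasDerivWithinAt)
    ((intervalIntegrable_iff_integrableOn_Icc_of_le ht).1 hgi) (fun s hs => by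
      have hm : 0 < mgf F μ s := mgf_pos (hexp s (hs.2.trans htc).le)
      have h1 := cov_norm_exp_norm_le a hs.1.le (hs.2.trans htc) hl hρ hμ (hg s hs.1 hs.2)
        (htg s hs.1 hs.2)
      rw [sub_le_iff_le_add, div_le_iff₀ hm]
      rw [mgf] at hm ⊢
      linarith)
  simp only [mgf_zero', zero_mul, sub_zero] at h
  have hm : 0 < mgf F μ t := mgf_pos (hexp t htc.le)
  have h0 : Real.log (μ.real Set.univ) = 0 := by simp
  rw [h0, sub_zero] at h
  exact (Real.log_le_iff_le_exp hm).1 (by linarith)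

end LogLaplace

/-! ### Approximation by compound Poisson laws -/

section CompensatedIntegral

/-- The complement of the closed ball of radius `1 / (n + 1)`. -/
def farSet (E : Type*) [NormedAddCommGroup E] (n : ℕ) : Set E := {u | ((n : ℝ) + 1)⁻¹ < ‖u‖}

lemma monotone_farSet (E : Type*) [NormedAddCommGroup E] : Monotone (farSet E) := by
  intro m n hmn u hu
  have hu' : ((m : ℝ) + 1)⁻¹ < ‖u‖ := hu
  refine lt_of_le_of_lt (b := ((m : ℝ) + 1)⁻¹) ?_ hu'
  gcongr

lemma iUnion_farSet (E : Type*) [NormedAddCommGroup E] : ⋃ n, farSet E n = {0}ᶜ := by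
  ext u
  simp only [farSet, Set.mem_iUnion, Set.mem_ofPred_eq, Set.mem_compl_iff, Set.mem_singleton_iff]
  constructor
  · rintro ⟨n, hn⟩ rfl
    rw [norm_zero] at hn
    exact absurd hn (not_lt.2 (by positivity))
  · intro hu
    obtain ⟨n, hn⟩ := exists_nat_one_div_lt (norm_pos_iff.2 hu)
    exact ⟨n, by simpa using hn⟩

lemma one_lt_norm_mem_farSet {E : Type*} [NormedAddCommGroup E] {u : E} (hu : 1 < ‖u‖)
    (n : ℕ) : u ∈ farSet E n := by
  refine lt_of_le_of_lt ?_ hu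
  exact inv_le_one_of_one_le₀ (by linarith [(n.cast_nonneg : (0 : ℝ) ≤ n)])

section Kernel

variable {E : Type*} [NormedAddCommGroup E] [InnerProductSpace ℝ E]

/-- The compensated integrand `e ^ (z ⟨t, u⟩) - 1 - z ⟨t, u⟩ 1_{‖u‖ ≤ 1}`. The value `z = i` gives
the Lévy-Khintchine exponent, `z = 1` the logarithm of the Laplace transform. -/
noncomputable def levyKernel (z : ℂ) (t u : E) : ℂ :=
  Complex.exp (z * ((⟪t, u⟫ : ℝ) : ℂ)) - 1 -
    (Metric.closedBall (0 : E) 1).indicator (fun v => z * ((⟪t, v⟫ : ℝ) : ℂ)) u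

lemma norm_levyKernel_le (z : ℂ) (t u : E) :
    ‖levyKernel z t u‖ ≤ ((‖z‖ * ‖t‖) ^ 2 * Real.exp (‖z‖ * ‖t‖) + 1) * min 1 (‖u‖ ^ 2) +
      {u : E | 1 < ‖u‖}.indicator (fun u => Real.exp (z.re * ⟪t, u⟫)) u := by
  by_cases hu : ‖u‖ ≤ 1
  · have hu' : u ∉ {u : E | 1 < ‖u‖} := not_lt.2 hu
    rw [levyKernel, Set.indicator_of_mem (by simpa using hu), Set.indicator_of_notMem hu', add_zero,
      min_eq_right (pow_le_one₀ (norm_nonneg u) hu)]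
    have h := Complex.norm_exp_sub_sum_le_norm_mul_exp (z * ((⟪t, u⟫ : ℝ) : ℂ)) 2
    simp only [Finset.sum_range_succ, Finset.sum_range_zero, pow_zero, pow_one,
      Nat.factorial_zero, Nat.factorial_one, Nat.cast_one, div_one, zero_add] at h
    rw [← sub_sub] at h
    have h1 : ‖z * ((⟪t, u⟫ : ℝ) : ℂ)‖ ≤ ‖z‖ * ‖t‖ * ‖u‖ := by
      rw [norm_mul, Complex.norm_real, mul_assoc]
      gcongr
      exact norm_inner_le_norm t u
    have h2 : ‖z * ((⟪t, u⟫ : ℝ) : ℂ)‖ ≤ ‖z‖ * ‖t‖ :=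
      h1.trans (mul_le_of_le_one_right (by positivity) hu)
    calc _ ≤ _ := h
      _ ≤ (‖z‖ * ‖t‖ * ‖u‖) ^ 2 * Real.exp (‖z‖ * ‖t‖) := by gcongr
      _ ≤ _ := by nlinarith [sq_nonneg ‖u‖]
  · rw [not_le] at hu
    have hu1 : u ∉ Metric.closedBall (0 : E) 1 := by simpa using hu
    rw [levyKernel, Set.indicator_of_notMem hu1, sub_zero,
      Set.indicator_of_mem (show u ∈ {u : E | 1 < ‖u‖} from hu),
      min_eq_left (one_le_pow₀ hu.le), mul_one]
    refine (norm_sub_le _ _).trans ?_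
    rw [Complex.norm_exp, norm_one]
    have : (z * ((⟪t, u⟫ : ℝ) : ℂ)).re = z.re * ⟪t, u⟫ := by simp
    rw [this]
    have : 0 ≤ (‖z‖ * ‖t‖) ^ 2 * Real.exp (‖z‖ * ‖t‖) := by positivity
    linarith

end Kernel

variable {E : Type*} [NormedAddCommGroup E] [MeasurableSpace E]

lemma IsLevyMeasure.restrict {ν : Measure E} (hν : IsLevyMeasure ν) (S : Set E) :
    IsLevyMeasure (ν.restrict S) where
  zero_atom := le_antisymm ((Measure.restrict_apply_le S {0}).trans hν.zero_atom.le) zero_le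
  lintegral_lt_top := (lintegral_mono' Measure.restrict_le_self le_rfl).trans_lt hν.lintegral_lt_top

variable [BorelSpace E]

lemma IsLevyMeasure.integrable_min {ν : Measure E} (hν : IsLevyMeasure ν) :
    Integrable (fun u => min 1 (‖u‖ ^ 2)) ν := by
  refine ⟨(Continuous.measurable (by fun_prop)).aestronglyMeasurable, ?_⟩
  rw [hasFiniteIntegral_iff_ofReal (ae_of_all _ fun _ => by positivity)]
  exact hν.lintegral_lt_top

lemma measurableSet_farSet (n : ℕ) : MeasurableSet (farSet E n) :=
  (isOpen_lt continuous_const continuous_norm).measurableSet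

lemma IsLevyMeasure.isFiniteMeasure_restrict_farSet {ν : Measure E} (hν : IsLevyMeasure ν) (n : ℕ) :
    IsFiniteMeasure (ν.restrict (farSet E n)) := by
  refine ⟨?_⟩
  rw [Measure.restrict_apply_univ]
  have h := hν.integrable_min.measure_ge_lt_top (ε := (((n : ℝ) + 1)⁻¹) ^ 2) (by positivity)
  refine (measure_mono fun u hu => ?_).trans_lt h
  have h1 : ((n : ℝ) + 1)⁻¹ ≤ 1 :=
    inv_le_one_of_one_le₀ (by linarith [(n.cast_nonneg : (0 : ℝ) ≤ n)])
  refine le_min (pow_le_one₀ (by positivity) h1) ?_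
  have : ((n : ℝ) + 1)⁻¹ < ‖u‖ := hu
  gcongr

lemma IsLevyMeasure.measure_one_lt_norm_lt_top {ν : Measure E} (hν : IsLevyMeasure ν) :
    ν {u | 1 < ‖u‖} < ⊤ := by
  have h := hν.integrable_min.measure_ge_lt_top (ε := 1) one_pos
  refine (measure_mono fun u hu => ?_).trans_lt h
  have hu' : 1 < ‖u‖ := hu
  exact le_min le_rfl (one_le_pow₀ hu'.le)

lemma integrableOn_id_inter_closedBall [SecondCountableTopology E] {ν : Measure E}
    (hν : IsLevyMeasure ν) (n : ℕ) :
    IntegrableOn (fun u : E => u) (farSet E n ∩ Metric.closedBall 0 1) ν := by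
  have := hν.isFiniteMeasure_restrict_farSet n
  refine Measure.integrableOn_of_bounded (M := 1) ?_ (by fun_prop) ?_
  · refine ((measure_mono Set.inter_subset_left).trans_lt ?_).ne
    have := measure_lt_top (ν.restrict (farSet E n)) Set.univ
    rwa [Measure.restrict_apply_univ] at this
  · refine (ae_restrict_iff' ((measurableSet_farSet n).inter
      Metric.isClosed_closedBall.measurableSet)).2 (ae_of_all _ fun u hu => ?_)
    simpa using hu.2

variable [InnerProductSpace ℝ E]

lemma measurable_levyKernel [SecondCountableTopology E] (z : ℂ) (t : E) :
    Measurable (levyKernel z t) := by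
  unfold levyKernel
  refine Measurable.sub (by fun_prop) (Measurable.indicator (by fun_prop) ?_)
  exact Metric.isClosed_closedBall.measurableSet

lemma integrable_levyKernel [SecondCountableTopology E] {ν : Measure E} (hν : IsLevyMeasure ν)
    {z : ℂ} {t : E} (h : IntegrableOn (fun u => Real.exp (z.re * ⟪t, u⟫)) {u | 1 < ‖u‖} ν) :
    Integrable (levyKernel z t) ν :=
  ((hν.integrable_min.const_mul _).add (h.integrable_indicator
    (isOpen_lt continuous_const continuous_norm).measurableSet)).mono'
      (measurable_levyKernel z t).aestronglyMeasurable
      (ae_of_all _ fun u => norm_levyKernel_le z t u)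

lemma integrable_levyKernel_I [SecondCountableTopology E] {ν : Measure E} (hν : IsLevyMeasure ν)
    (t : E) : Integrable (levyKernel I t) ν := by
  refine integrable_levyKernel hν ?_
  simp only [Complex.I_re, zero_mul, Real.exp_zero]
  exact integrableOn_const hν.measure_one_lt_norm_lt_top.ne

/-- The compensated integrals over `farSet E n` exhaust the full integral. -/
lemma tendsto_setIntegral_levyKernel {ν : Measure E}
    (hν : IsLevyMeasure ν) {z : ℂ} {t : E} (h : Integrable (levyKernel z t) ν) :
    Tendsto (fun n => ∫ u in farSet E n, levyKernel z t u ∂ν) atTop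
      (𝓝 (∫ u, levyKernel z t u ∂ν)) := by
  have h1 := tendsto_setIntegral_of_monotone (fun n => measurableSet_farSet (E := E) n)
    (monotone_farSet E) (h.integrableOn (s := ⋃ n, farSet E n))
  rwa [iUnion_farSet, Measure.restrict_eq_self_of_ae_mem] at h1
  rw [ae_iff]
  simpa using hν.zero_atom

lemma setIntegral_levyKernel [CompleteSpace E] [SecondCountableTopology E] {ν : Measure E}
    (hν : IsLevyMeasure ν) (n : ℕ) {z : ℂ} {t : E}
    (h : IntegrableOn (fun u => Complex.exp (z * ((⟪t, u⟫ : ℝ) : ℂ))) (farSet E n) ν) :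
    ∫ u in farSet E n, levyKernel z t u ∂ν =
      (∫ u in farSet E n, Complex.exp (z * ((⟪t, u⟫ : ℝ) : ℂ)) ∂ν)
        - ((ν.restrict (farSet E n)).real Set.univ : ℝ)
        - z * ((⟪t, ∫ u in farSet E n ∩ Metric.closedBall 0 1, u ∂ν⟫ : ℝ) : ℂ) := by
  have := hν.isFiniteMeasure_restrict_farSet n
  have hb : MeasurableSet (Metric.closedBall (0 : E) 1) := Metric.isClosed_closedBall.measurableSet
  have hid := integrableOn_id_inter_closedBall hν n
  have hin : IntegrableOn (fun v : E => z * ((⟪t, v⟫ : ℝ) : ℂ))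
      (farSet E n ∩ Metric.closedBall 0 1) ν := by
    have : IntegrableOn (fun v : E => ⟪t, v⟫) (farSet E n ∩ Metric.closedBall 0 1) ν :=
      hid.const_inner t
    exact this.ofReal.const_mul z
  have hin' : IntegrableOn ((Metric.closedBall (0 : E) 1).indicator
      fun v : E => z * ((⟪t, v⟫ : ℝ) : ℂ)) (farSet E n) ν := by
    rw [integrableOn_indicator_iff hb, Set.inter_comm]
    exact hin
  unfold levyKernel
  have h1 : IntegrableOn (fun u => Complex.exp (z * ((⟪t, u⟫ : ℝ) : ℂ)) - 1) (farSet E n) ν :=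
    h.sub (integrable_const (1 : ℂ))
  rw [integral_sub h1 hin', integral_sub h (integrable_const _),
    setIntegral_indicator hb, integral_const_mul, integral_complex_ofReal, integral_inner hid t]
  simp

end CompensatedIntegral

section LevyApprox

variable {E : Type*} [NormedAddCommGroup E] [InnerProductSpace ℝ E] [MeasurableSpace E]

/-- The compound Poisson law obtained from the infinitely divisible law with drift `γ` and Lévy
measure `ν` by removing the jumps of norm at most `1 / (n + 1)`, together with their
compensation. -/
noncomputable def levyApprox (γ : E) (ν : Measure E) (n : ℕ) : Measure E :=
  shiftedCompoundPoisson (γ - ∫ u in farSet E n ∩ Metric.closedBall 0 1, u ∂ν)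
    (ν.restrict (farSet E n))

variable [BorelSpace E] [SecondCountableTopology E]

lemma IsLevyMeasure.isProbabilityMeasure_levyApprox {ν : Measure E} (hν : IsLevyMeasure ν) (γ : E)
    (n : ℕ) : IsProbabilityMeasure (levyApprox γ ν n) := by
  have := hν.isFiniteMeasure_restrict_farSet n
  unfold levyApprox
  infer_instance

lemma charFun_shiftedCompoundPoisson (a : E) (ν : Measure E) [IsFiniteMeasure ν] (t : E) :
    charFun (shiftedCompoundPoisson a ν) t =
      Complex.exp (I * ((⟪t, a⟫ : ℝ) : ℂ) + (∫ u, Complex.exp (I * ((⟪t, u⟫ : ℝ) : ℂ)) ∂ν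
        - (ν.real Set.univ : ℝ))) := by
  rw [charFun_eq_charFunDual_toDualMap, charFunDual_shiftedCompoundPoisson, charFunDual_apply]
  simp only [InnerProductSpace.toDualMap_apply_apply, mul_comm I]

/-- The Laplace transform of a compound Poisson law is finite wherever that of its Lévy measure
is. -/
lemma lintegral_exp_inner_shiftedCompoundPoisson_le (a : E) (ν : Measure E) [IsFiniteMeasure ν]
    {s : E} (h : Integrable (fun u => Real.exp ⟪s, u⟫) ν) :
    ∫⁻ x, ENNReal.ofReal (Real.exp ⟪s, x⟫) ∂(shiftedCompoundPoisson a ν) ≤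
      ENNReal.ofReal (Real.exp (⟪s, a⟫ + (∫ u, Real.exp ⟪s, u⟫ ∂ν - ν.real Set.univ))) := by
  rw [shiftedCompoundPoisson, lintegral_map (by fun_prop) (by fun_prop)]
  simp only [inner_add_right, Real.exp_add, ENNReal.ofReal_mul (Real.exp_pos _).le]
  rw [lintegral_const_mul _ (by fun_prop)]
  gcongr
  have h1 := lintegral_compoundPoisson_le ν 1 (χ := fun x => ENNReal.ofReal (Real.exp ⟪s, x⟫))
    (by fun_prop) (by simp) (fun x y => by
      rw [← ENNReal.ofReal_mul (Real.exp_pos _).le, ← Real.exp_add, inner_add_right])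
    (m := ∫ u, Real.exp ⟪s, u⟫ ∂ν) (by positivity)
    (by rw [ofReal_integral_eq_lintegral_ofReal h (ae_of_all _ fun _ => by positivity)])
  simpa using h1

variable [CompleteSpace E]

lemma charFun_levyApprox {ν : Measure E} (hν : IsLevyMeasure ν) (γ : E) (n : ℕ) (t : E) :
    charFun (levyApprox γ ν n) t = Complex.exp (I * ((⟪t, γ⟫ : ℝ) : ℂ) +
      ∫ u in farSet E n, levyKernel I t u ∂ν) := by
  have := hν.isFiniteMeasure_restrict_farSet n
  have hi : IntegrableOn (fun u => Complex.exp (I * ((⟪t, u⟫ : ℝ) : ℂ))) (farSet E n) ν := by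
    refine (integrable_const (1 : ℝ)).mono' (by fun_prop) (ae_of_all _ fun u => ?_)
    rw [mul_comm, Complex.norm_exp_ofReal_mul_I]
  rw [levyApprox, charFun_shiftedCompoundPoisson, setIntegral_levyKernel hν n hi, inner_sub_right]
  congr 1
  push_cast
  ring

lemma tendsto_charFun_levyApprox {ν : Measure E} (hν : IsLevyMeasure ν) (γ t : E) :
    Tendsto (fun n => charFun (levyApprox γ ν n) t) atTop
      (𝓝 (Complex.exp (levyExponent γ ν t))) := by
  simp only [charFun_levyApprox hν]
  exact ((tendsto_setIntegral_levyKernel hν (integrable_levyKernel_I hν t)).const_add _).cexp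

/-- Splitting off the jumps of norm larger than `1`. -/
lemma levyApprox_eq_conv {ν : Measure E} (hν : IsLevyMeasure ν) (γ : E) (n : ℕ) :
    levyApprox γ ν n = compoundPoisson (ν.restrict {u | 1 < ‖u‖}) 1 ∗
      levyApprox γ (ν.restrict (Metric.closedBall 0 1)) n := by
  have h1 := hν.restrict (Metric.closedBall 0 1)
  have := hν.isProbabilityMeasure_levyApprox γ n
  have := h1.isProbabilityMeasure_levyApprox γ n
  have : IsFiniteMeasure (ν.restrict {u | 1 < ‖u‖}) :=
    ⟨by rw [Measure.restrict_apply_univ]; exact hν.measure_one_lt_norm_lt_top⟩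
  have hb : MeasurableSet (Metric.closedBall (0 : E) 1) := Metric.isClosed_closedBall.measurableSet
  refine Measure.ext_of_charFun (funext fun t => ?_)
  rw [charFun_conv, charFun_levyApprox hν, charFun_levyApprox h1,
    charFun_eq_charFunDual_toDualMap (μ := compoundPoisson _ _), charFunDual_compoundPoisson,
    ← Complex.exp_add, charFunDual_apply, Measure.restrict_restrict (measurableSet_farSet n),
    ← integral_inter_add_sdiff hb (integrable_levyKernel_I hν t).integrableOn]
  have e : farSet E n \ Metric.closedBall 0 1 = {u | 1 < ‖u‖} := by
    ext u
    constructor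
    · intro hu
      simpa using hu.2
    · intro hu
      exact ⟨one_lt_norm_mem_farSet hu n, by simpa using hu⟩
  have e2 : ∫ u in {u : E | 1 < ‖u‖}, levyKernel I t u ∂ν =
      ∫ u in {u : E | 1 < ‖u‖}, (Complex.exp ((⟪t, u⟫ : ℝ) * I) - 1) ∂ν := by
    refine setIntegral_congr_fun (isOpen_lt continuous_const continuous_norm).measurableSet
      fun u hu => ?_
    have hu1 : u ∉ Metric.closedBall (0 : E) 1 := by simpa using hu
    simp only [levyKernel, Set.indicator_of_notMem hu1, sub_zero, mul_comm I]
  have hi : Integrable (fun u => Complex.exp ((⟪t, u⟫ : ℝ) * I)) (ν.restrict {u | 1 < ‖u‖}) := by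
    refine (integrable_const (1 : ℝ)).mono' (by fun_prop) (ae_of_all _ fun u => ?_)
    rw [Complex.norm_exp_ofReal_mul_I]
  rw [e, e2, integral_sub hi (integrable_const _)]
  congr 1
  simp
  ring

/-- A bound which does not depend on the approximation. -/
lemma lintegral_exp_inner_levyApprox_le {ν : Measure E} (hν : IsLevyMeasure ν) (γ : E) {s : E}
    (h : IntegrableOn (fun u => Real.exp ⟪s, u⟫) {u | 1 < ‖u‖} ν) (n : ℕ) :
    ∫⁻ x, ENNReal.ofReal (Real.exp ⟪s, x⟫) ∂(levyApprox γ ν n) ≤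
      ENNReal.ofReal (Real.exp (⟪s, γ⟫ + ∫ u, ‖levyKernel 1 s u‖ ∂ν)) := by
  have := hν.isFiniteMeasure_restrict_farSet n
  have hk : Integrable (levyKernel 1 s) ν := integrable_levyKernel hν (by simpa using h)
  have hS : Integrable (fun u => Real.exp ⟪s, u⟫) (ν.restrict (farSet E n)) := by
    have h1 : IntegrableOn (fun u => Real.exp ⟪s, u⟫) (farSet E n ∩ Metric.closedBall 0 1) ν := by
      have hf : IsFiniteMeasure (ν.restrict (farSet E n ∩ Metric.closedBall 0 1)) :=
        ⟨by
          rw [Measure.restrict_apply_univ]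
          refine (measure_mono Set.inter_subset_left).trans_lt ?_
          have := measure_lt_top (ν.restrict (farSet E n)) Set.univ
          rwa [Measure.restrict_apply_univ] at this⟩
      refine (integrable_const (Real.exp ‖s‖)).mono' (by fun_prop) ?_
      refine (ae_restrict_iff' ((measurableSet_farSet n).inter
        Metric.isClosed_closedBall.measurableSet)).2 (ae_of_all _ fun u hu => ?_)
      have hu1 : ‖u‖ ≤ 1 := by simpa using hu.2
      rw [Real.norm_eq_abs, Real.abs_exp]
      apply Real.exp_le_exp.2
      exact (real_inner_le_norm s u).trans (mul_le_of_le_one_right (norm_nonneg s) hu1)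
    refine (h1.union h).mono_set fun u hu => ?_
    by_cases hu1 : 1 < ‖u‖
    · exact Or.inr hu1
    · exact Or.inl ⟨hu, by simpa using hu1⟩
  have hSc : IntegrableOn (fun u => Complex.exp (1 * ((⟪s, u⟫ : ℝ) : ℂ))) (farSet E n) ν := by
    simp only [one_mul, ← Complex.ofReal_exp]
    exact hS.ofReal
  rw [levyApprox]
  refine (lintegral_exp_inner_shiftedCompoundPoisson_le _ _ hS).trans ?_
  gcongr ENNReal.ofReal (Real.exp ?_)
  have e := congrArg Complex.re (setIntegral_levyKernel hν n hSc)
  simp only [one_mul, ← Complex.ofReal_exp, integral_complex_ofReal, Complex.sub_re,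
    Complex.ofReal_re] at e
  rw [inner_sub_right]
  have h2 : (∫ u in farSet E n, levyKernel 1 s u ∂ν).re ≤ ∫ u, ‖levyKernel 1 s u‖ ∂ν :=
    (Complex.re_le_norm _).trans ((norm_integral_le_integral_norm _).trans
      (setIntegral_le_integral hk.norm (ae_of_all _ fun _ => norm_nonneg _)))
  linarith

end LevyApprox

/-! ### Passage to the limit -/

section Limit

variable {d : ℕ} {ν : Measure (EuclideanSpace ℝ (Fin d))} {γ : EuclideanSpace ℝ (Fin d)}

lemma exists_norm_le_card_mul_abs [NeZero d] (x : EuclideanSpace ℝ (Fin d)) :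
    ∃ k : Fin d, ‖x‖ ≤ d * |x k| := by
  obtain ⟨k, -, hk⟩ := Finset.exists_max_image Finset.univ (fun k => |x k|)
    ⟨(0 : Fin d), Finset.mem_univ _⟩
  refine ⟨k, abs_le_of_sq_le_sq' ?_ (by positivity) |>.2⟩
  have hd : (1 : ℝ) ≤ d := by exact_mod_cast NeZero.one_le
  calc ‖x‖ ^ 2 = ∑ j, |x j| ^ 2 := by
        rw [EuclideanSpace.real_norm_sq_eq]; simp
    _ ≤ ∑ _j : Fin d, |x k| ^ 2 := by
        refine Finset.sum_le_sum fun j hj => ?_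
        exact pow_le_pow_left₀ (abs_nonneg _) (hk j hj) 2
    _ = d * |x k| ^ 2 := by simp
    _ ≤ d * (d * |x k| ^ 2) := le_mul_of_one_le_left (by positivity) hd
    _ = _ := by ring

lemma exp_norm_le_sum_exp_inner [NeZero d] {c : ℝ} (hc : 0 ≤ c) (x : EuclideanSpace ℝ (Fin d)) :
    Real.exp (c / d * ‖x‖) ≤ ∑ k : Fin d, (Real.exp ⟪EuclideanSpace.single k c, x⟫
      + Real.exp ⟪EuclideanSpace.single k (-c), x⟫) := by
  obtain ⟨k, hk⟩ := exists_norm_le_card_mul_abs x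
  have hd : (0 : ℝ) < d := by exact_mod_cast NeZero.pos d
  have h1 : c / d * ‖x‖ ≤ c * |x k| := by
    calc c / d * ‖x‖ ≤ c / d * (d * |x k|) := by gcongr
      _ = _ := by field_simp
  have h2 : Real.exp (c / d * ‖x‖) ≤ Real.exp ⟪EuclideanSpace.single k c, x⟫
      + Real.exp ⟪EuclideanSpace.single k (-c), x⟫ := by
    rw [EuclideanSpace.inner_single_left, EuclideanSpace.inner_single_left]
    simp only [conj_trivial]
    refine (Real.exp_le_exp.2 h1).trans ?_
    rcases abs_cases (x k) with ⟨h, -⟩ | ⟨h, -⟩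
    · rw [h]; linarith [Real.exp_pos (-c * x k)]
    · rw [h, mul_neg, ← neg_mul]; linarith [Real.exp_pos (c * x k)]
  exact h2.trans (Finset.single_le_sum (f := fun k : Fin d =>
    Real.exp ⟪EuclideanSpace.single k c, x⟫ + Real.exp ⟪EuclideanSpace.single k (-c), x⟫)
    (fun j _ => by positivity) (Finset.mem_univ k))

/-- Uniform exponential moments of the approximations. -/
lemma exists_integral_exp_norm_levyApprox_le [NeZero d] (hν : IsLevyMeasure ν)
    (γ : EuclideanSpace ℝ (Fin d)) {c : ℝ} (hc : 0 < c)
    (h : IntegrableOn (fun u => Real.exp (c * ‖u‖)) {u | 1 < ‖u‖} ν) :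
    ∃ C : ℝ, ∀ n, Integrable (fun x => Real.exp (c / d * ‖x‖)) (levyApprox γ ν n) ∧
      ∫ x, Real.exp (c / d * ‖x‖) ∂(levyApprox γ ν n) ≤ C := by
  have hs : ∀ s : EuclideanSpace ℝ (Fin d), ‖s‖ ≤ c →
      IntegrableOn (fun u => Real.exp ⟪s, u⟫) {u | 1 < ‖u‖} ν := by
    intro s hs
    refine h.mono' (by fun_prop) (ae_of_all _ fun u => ?_)
    rw [Real.norm_eq_abs, Real.abs_exp]
    apply Real.exp_le_exp.2
    exact (real_inner_le_norm s u).trans (by gcongr)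
  have hpos : ∀ k : Fin d, ‖(EuclideanSpace.single k c : EuclideanSpace ℝ (Fin d))‖ ≤ c := by
    intro k; simp [abs_of_pos hc]
  have hneg : ∀ k : Fin d, ‖(EuclideanSpace.single k (-c) : EuclideanSpace ℝ (Fin d))‖ ≤ c := by
    intro k; simp [abs_of_pos hc]
  set B : EuclideanSpace ℝ (Fin d) → ℝ := fun s =>
    Real.exp (⟪s, γ⟫ + ∫ u, ‖levyKernel 1 s u‖ ∂ν)
  have hB0 : ∀ s, 0 ≤ B s := fun s => (Real.exp_pos _).le
  have key : ∀ n, ∫⁻ x, ENNReal.ofReal (Real.exp (c / d * ‖x‖)) ∂(levyApprox γ ν n) ≤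
      ENNReal.ofReal (∑ k : Fin d, (B (EuclideanSpace.single k c)
        + B (EuclideanSpace.single k (-c)))) := by
    intro n
    calc ∫⁻ x, ENNReal.ofReal (Real.exp (c / d * ‖x‖)) ∂(levyApprox γ ν n)
        ≤ ∫⁻ x, ∑ k : Fin d, (ENNReal.ofReal (Real.exp ⟪EuclideanSpace.single k c, x⟫)
            + ENNReal.ofReal (Real.exp ⟪EuclideanSpace.single k (-c), x⟫))
              ∂(levyApprox γ ν n) := by
          refine lintegral_mono fun x => ?_
          refine (ENNReal.ofReal_le_ofReal (exp_norm_le_sum_exp_inner hc.le x)).trans ?_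
          rw [ENNReal.ofReal_sum_of_nonneg fun k _ => by positivity]
          gcongr with k
          exact ENNReal.ofReal_add_le
      _ = ∑ k : Fin d,
          (∫⁻ x, ENNReal.ofReal (Real.exp ⟪EuclideanSpace.single k c, x⟫) ∂(levyApprox γ ν n)
          + ∫⁻ x, ENNReal.ofReal (Real.exp ⟪EuclideanSpace.single k (-c), x⟫)
              ∂(levyApprox γ ν n)) := by
          rw [lintegral_finsetSum _ fun k _ => by fun_prop]
          refine Finset.sum_congr rfl fun k _ => ?_
          rw [lintegral_add_left (by fun_prop)]
      _ ≤ ∑ k : Fin d, (ENNReal.ofReal (B (EuclideanSpace.single k c))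
            + ENNReal.ofReal (B (EuclideanSpace.single k (-c)))) := by
          gcongr with k
          · exact lintegral_exp_inner_levyApprox_le hν γ (hs _ (hpos k)) n
          · exact lintegral_exp_inner_levyApprox_le hν γ (hs _ (hneg k)) n
      _ = _ := by
          rw [ENNReal.ofReal_sum_of_nonneg fun k _ => add_nonneg (hB0 _) (hB0 _)]
          refine Finset.sum_congr rfl fun k _ => ?_
          rw [ENNReal.ofReal_add (hB0 _) (hB0 _)]
  refine ⟨∑ k : Fin d, (B (EuclideanSpace.single k c) + B (EuclideanSpace.single k (-c))),
    fun n => ?_⟩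
  have hi : Integrable (fun x => Real.exp (c / d * ‖x‖)) (levyApprox γ ν n) := by
    refine ⟨by fun_prop, ?_⟩
    rw [hasFiniteIntegral_iff_ofReal (ae_of_all _ fun _ => by positivity)]
    exact (key n).trans_lt ENNReal.ofReal_lt_top
  refine ⟨hi, ?_⟩
  have h1 := key n
  rw [← ofReal_integral_eq_lintegral_ofReal hi (ae_of_all _ fun _ => by positivity)] at h1
  exact (ENNReal.ofReal_le_ofReal_iff
    (Finset.sum_nonneg fun k _ => add_nonneg (hB0 _) (hB0 _))).1 h1

variable {μ : Measure (EuclideanSpace ℝ (Fin d))} [IsProbabilityMeasure μ]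

/-- Weak convergence of the approximations, by Lévy's theorem. -/
lemma tendsto_integral_levyApprox (hν : IsLevyMeasure ν)
    (hμ : ∀ t, charFun μ t = Complex.exp (levyExponent γ ν t))
    {f : EuclideanSpace ℝ (Fin d) → ℝ} (hf : Continuous f) {B : ℝ} (hB : ∀ x, ‖f x‖ ≤ B) :
    Tendsto (fun n => ∫ x, f x ∂(levyApprox γ ν n)) atTop (𝓝 (∫ x, f x ∂μ)) := by
  have h := (ProbabilityMeasure.tendsto_iff_tendsto_charFun
    (μ := fun n => ⟨levyApprox γ ν n, hν.isProbabilityMeasure_levyApprox γ n⟩)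
    (μ₀ := ⟨μ, inferInstance⟩)).2 (fun t => by
      simpa only [ProbabilityMeasure.coe_mk, hμ] using tendsto_charFun_levyApprox hν γ t)
  exact ProbabilityMeasure.tendsto_iff_forall_integral_tendsto.1 h
    (BoundedContinuousFunction.ofNormedAddCommGroup f hf B hB)

/-- Half of the mass of the laws without large jumps stays in a fixed ball. -/
lemma exists_half_le_levyApprox_closedBall [NeZero d] (hν : IsLevyMeasure ν) :
    ∃ R : ℝ, 0 ≤ R ∧ ∀ n, 2⁻¹ ≤ levyApprox γ (ν.restrict (Metric.closedBall 0 1)) n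
      (Metric.closedBall 0 R) := by
  have h1 := hν.restrict (Metric.closedBall 0 1)
  have h0 : (ν.restrict (Metric.closedBall 0 1)) {u | 1 < ‖u‖} = 0 := by
    rw [Measure.restrict_apply (isOpen_lt continuous_const continuous_norm).measurableSet]
    have : {u : EuclideanSpace ℝ (Fin d) | 1 < ‖u‖} ∩ Metric.closedBall 0 1 = ∅ := by
      ext u
      simp
    rw [this, measure_empty]
  obtain ⟨C, hC⟩ := exists_integral_exp_norm_levyApprox_le h1 γ one_pos
    (by rw [IntegrableOn, Measure.restrict_zero_set h0]; exact integrable_zero_measure)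
  have hd : (0 : ℝ) < d := by exact_mod_cast NeZero.pos d
  -- Markov's inequality for `e ^ (‖x‖ / d)` at a level above `2 C`
  obtain ⟨R, hR⟩ : ∃ R : ℝ, 0 ≤ R ∧ 2 * C ≤ Real.exp (1 / d * R) := by
    refine ⟨d * |2 * C|, by positivity, ?_⟩
    have : 1 / (d : ℝ) * (d * |2 * C|) = |2 * C| := by field_simp
    rw [this]
    linarith [Real.add_one_le_exp |2 * C|, le_abs_self (2 * C)]
  refine ⟨R, hR.1, fun n => ?_⟩
  have := h1.isProbabilityMeasure_levyApprox γ n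
  set m := levyApprox γ (ν.restrict (Metric.closedBall 0 1)) n
  have h2 : m.real (Metric.closedBall 0 R)ᶜ ≤ 1 / 2 := by
    have h3 := mul_meas_ge_le_integral_of_nonneg (μ := m)
      (f := fun x => Real.exp (1 / d * ‖x‖)) (ae_of_all _ fun _ => by positivity) (hC n).1
      (Real.exp (1 / d * R))
    have h4 : m.real (Metric.closedBall 0 R)ᶜ ≤
        m.real {x | Real.exp (1 / d * R) ≤ Real.exp (1 / d * ‖x‖)} := by
      refine measureReal_mono fun x hx => ?_
      have hx' : R < ‖x‖ := by simpa using hx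
      exact Real.exp_le_exp.2 (by gcongr)
    have h5 : Real.exp (1 / d * R) * m.real (Metric.closedBall 0 R)ᶜ ≤ C :=
      (mul_le_mul_of_nonneg_left h4 (Real.exp_pos _).le).trans (h3.trans (hC n).2)
    have h6 : 0 < Real.exp (1 / d * R) := Real.exp_pos _
    by_contra hcon
    rw [not_le] at hcon
    nlinarith
  have h8 : m.real (Metric.closedBall 0 R) = 1 - m.real (Metric.closedBall 0 R)ᶜ := by
    rw [probReal_compl_eq_one_sub Metric.isClosed_closedBall.measurableSet]; ring
  have h9 : 1 / 2 ≤ m.real (Metric.closedBall 0 R) := by linarith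
  have h10 := ENNReal.ofReal_le_ofReal h9
  rw [ofReal_measureReal] at h10
  refine le_trans (le_of_eq ?_) h10
  rw [one_div, ENNReal.ofReal_inv_of_pos two_pos]
  simp

/-- An exponential moment of an infinitely divisible law is inherited by the large jumps of its Lévy
measure: the law is the convolution of the law of the large jumps with a law that charges a fixed
ball, and the law of the large jumps dominates a multiple of their Lévy measure. -/
lemma integrableOn_exp_norm_of_integrable [NeZero d] (hν : IsLevyMeasure ν)
    (hμ : ∀ t, charFun μ t = Complex.exp (levyExponent γ ν t)) {c : ℝ} (hc : 0 ≤ c)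
    (h : Integrable (fun x => Real.exp (c * ‖x‖)) μ) :
    IntegrableOn (fun u => Real.exp (c * ‖u‖)) {u | 1 < ‖u‖} ν := by
  have : IsFiniteMeasure (ν.restrict {u | 1 < ‖u‖}) :=
    ⟨by rw [Measure.restrict_apply_univ]; exact hν.measure_one_lt_norm_lt_top⟩
  obtain ⟨R, hR0, hR⟩ := exists_half_le_levyApprox_closedBall (γ := γ) hν
  set Z := compoundPoisson (ν.restrict {u | 1 < ‖u‖}) 1
  set D := ∫ x, Real.exp (c * ‖x‖) ∂μ
  -- the truncated moments of the large jumps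
  have key : ∀ K : ℕ, ∫⁻ z, ENNReal.ofReal (min (Real.exp (c * ‖z‖ - c * R)) K) ∂Z ≤
      2 * ENNReal.ofReal D := by
    intro K
    have hcont : Continuous fun x : EuclideanSpace ℝ (Fin d) => min (Real.exp (c * ‖x‖)) (K : ℝ) :=
      by fun_prop
    have hbd : ∀ x : EuclideanSpace ℝ (Fin d), ‖min (Real.exp (c * ‖x‖)) (K : ℝ)‖ ≤ K := fun x => by
      rw [Real.norm_of_nonneg (by positivity)]; exact min_le_right _ _
    have hlim := tendsto_integral_levyApprox hν hμ hcont hbd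
    have hle : ∫ x, min (Real.exp (c * ‖x‖)) (K : ℝ) ∂μ ≤ D := by
      refine integral_mono ((integrable_const (K : ℝ)).mono' (by fun_prop) (ae_of_all _ hbd)) h ?_
      exact fun x => min_le_left _ _
    have hlower : ∀ n, 2⁻¹ * ∫⁻ z, ENNReal.ofReal (min (Real.exp (c * ‖z‖ - c * R)) K) ∂Z ≤
        ENNReal.ofReal (∫ x, min (Real.exp (c * ‖x‖)) (K : ℝ) ∂(levyApprox γ ν n)) := by
      intro n
      have := hν.isProbabilityMeasure_levyApprox γ n
      have := (hν.restrict (Metric.closedBall 0 1)).isProbabilityMeasure_levyApprox γ n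
      rw [ofReal_integral_eq_lintegral_ofReal
        ((integrable_const (K : ℝ)).mono' (by fun_prop) (ae_of_all _ hbd))
        (ae_of_all _ fun _ => by positivity), levyApprox_eq_conv hν,
        Measure.lintegral_conv (by fun_prop), mul_comm, ← lintegral_mul_const _ (by fun_prop)]
      refine lintegral_mono fun z => ?_
      calc ENNReal.ofReal (min (Real.exp (c * ‖z‖ - c * R)) K) * 2⁻¹
          ≤ ∫⁻ y in Metric.closedBall 0 R, ENNReal.ofReal (min (Real.exp (c * ‖z‖ - c * R)) K)
              ∂(levyApprox γ (ν.restrict (Metric.closedBall 0 1)) n) := by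
            rw [setLIntegral_const]
            gcongr
            exact hR n
        _ ≤ ∫⁻ y in Metric.closedBall 0 R, ENNReal.ofReal (min (Real.exp (c * ‖z + y‖)) K)
              ∂(levyApprox γ (ν.restrict (Metric.closedBall 0 1)) n) := by
            refine setLIntegral_mono (by fun_prop) fun y hy => ?_
            have hy' : ‖y‖ ≤ R := by simpa using hy
            gcongr
            have : ‖z‖ ≤ ‖z + y‖ + ‖y‖ := by simpa using norm_sub_le (z + y) y
            nlinarith
        _ ≤ _ := setLIntegral_le_lintegral _ _
    have h3 := ge_of_tendsto (ENNReal.tendsto_ofReal hlim) (Eventually.of_forall hlower)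
    have h4 := h3.trans (ENNReal.ofReal_le_ofReal hle)
    calc ∫⁻ z, ENNReal.ofReal (min (Real.exp (c * ‖z‖ - c * R)) K) ∂Z
        = 2 * (2⁻¹ * ∫⁻ z, ENNReal.ofReal (min (Real.exp (c * ‖z‖ - c * R)) K) ∂Z) := by
          rw [← mul_assoc, ENNReal.mul_inv_cancel two_ne_zero ENNReal.ofNat_ne_top, one_mul]
      _ ≤ _ := by gcongr
  have hmono : ∫⁻ z, ENNReal.ofReal (Real.exp (c * ‖z‖ - c * R)) ∂Z ≤ 2 * ENNReal.ofReal D := by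
    refine le_of_tendsto' (lintegral_tendsto_of_tendsto_of_monotone
      (f := fun (K : ℕ) z => ENNReal.ofReal (min (Real.exp (c * ‖z‖ - c * R)) K))
      (fun K => by fun_prop) (ae_of_all _ fun z => ?_) (ae_of_all _ fun z => ?_)) key
    · intro K L hKL
      simp only
      gcongr
    · refine tendsto_const_nhds.congr' ?_
      obtain ⟨K₀, hK₀⟩ := exists_nat_ge (Real.exp (c * ‖z‖ - c * R))
      filter_upwards [eventually_ge_atTop K₀] with K hK
      rw [min_eq_left (hK₀.trans (by exact_mod_cast hK))]
  have hfin : ∫⁻ z, ENNReal.ofReal (Real.exp (c * ‖z‖)) ∂Z < ⊤ := by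
    have e : ∀ z : EuclideanSpace ℝ (Fin d), ENNReal.ofReal (Real.exp (c * ‖z‖)) =
        ENNReal.ofReal (Real.exp (c * R)) * ENNReal.ofReal (Real.exp (c * ‖z‖ - c * R)) := by
      intro z
      rw [← ENNReal.ofReal_mul (by positivity), ← Real.exp_add]
      ring_nf
    simp only [e]
    rw [lintegral_const_mul _ (by fun_prop)]
    exact ENNReal.mul_lt_top ENNReal.ofReal_lt_top
      (hmono.trans_lt (ENNReal.mul_lt_top (by simp) ENNReal.ofReal_lt_top))
  refine ⟨by fun_prop, ?_⟩
  rw [hasFiniteIntegral_iff_ofReal (ae_of_all _ fun _ => by positivity)]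
  have hle := lintegral_mono' (smul_le_compoundPoisson_one (ν.restrict {u | 1 < ‖u‖}))
    (le_refl fun u => ENNReal.ofReal (Real.exp (c * ‖u‖)))
  rw [lintegral_smul_measure] at hle
  refine lt_top_iff_ne_top.2 fun htop => (hle.trans_lt hfin).ne ?_
  rw [htop, smul_eq_mul, ENNReal.mul_top]
  simp [Real.exp_pos]

end Limit

section LimitInequality

variable {d : ℕ} [NeZero d] {ν : Measure (EuclideanSpace ℝ (Fin d))}
  {γ : EuclideanSpace ℝ (Fin d)} {μ : Measure (EuclideanSpace ℝ (Fin d))} [IsProbabilityMeasure μ]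

lemma norm_le_min_add_exp {b K y : ℝ} (hb : 0 < b) (hK : 0 < K) (hy : 0 ≤ y) :
    y ≤ min y K + 2 / (b ^ 2 * K) * Real.exp (b * y) := by
  rcases le_total y K with h | h
  · rw [min_eq_left h]
    have : 0 ≤ 2 / (b ^ 2 * K) * Real.exp (b * y) := by positivity
    linarith
  · rw [min_eq_right h]
    have h1 := Real.pow_div_factorial_le_exp (b * y) (by positivity) 2
    have h2 : y ≤ 2 / (b ^ 2 * K) * Real.exp (b * y) := by
      rw [div_mul_eq_mul_div, le_div_iff₀ (by positivity)]
      have h3 : (b * y) ^ 2 ≤ 2 * Real.exp (b * y) := by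
        rw [div_le_iff₀ (by positivity)] at h1
        simpa [mul_comm] using h1
      nlinarith [mul_le_mul_of_nonneg_left h (by positivity : 0 ≤ b ^ 2 * y)]
    linarith

/-- The first moments of the approximations do not exceed that of the limit asymptotically, by
uniform integrability. -/
lemma eventually_integral_norm_levyApprox_le (hν : IsLevyMeasure ν)
    (hμ : ∀ t, charFun μ t = Complex.exp (levyExponent γ ν t)) {c : ℝ} (hc : 0 < c)
    (h : IntegrableOn (fun u => Real.exp (c * ‖u‖)) {u | 1 < ‖u‖} ν)
    (hint : Integrable (fun x => ‖x‖) μ) {ε : ℝ} (hε : 0 < ε) :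
    ∀ᶠ n in atTop, ∫ x, ‖x‖ ∂(levyApprox γ ν n) ≤ ∫ x, ‖x‖ ∂μ + ε := by
  obtain ⟨C, hC⟩ := exists_integral_exp_norm_levyApprox_le hν γ hc h
  have hd : (0 : ℝ) < d := by exact_mod_cast NeZero.pos d
  set b := c / d
  have hb0 : 0 < b := by positivity
  obtain ⟨K, hK0, hK⟩ : ∃ K : ℝ, 0 < K ∧ 2 / (b ^ 2 * K) * C ≤ ε / 2 := by
    refine ⟨4 * (|C| + 1) / (b ^ 2 * ε), by positivity, ?_⟩
    have e : 2 / (b ^ 2 * (4 * (|C| + 1) / (b ^ 2 * ε))) * C = ε / 2 * (C / (|C| + 1)) := by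
      field_simp
      norm_num
    rw [e]
    refine mul_le_of_le_one_right (by positivity) ?_
    rw [div_le_one (by positivity)]
    linarith [le_abs_self C]
  have hbd : ∀ x : EuclideanSpace ℝ (Fin d), ‖min ‖x‖ K‖ ≤ K := fun x => by
    rw [Real.norm_of_nonneg (by positivity)]; exact min_le_right _ _
  have hlim := tendsto_integral_levyApprox hν hμ (f := fun x => min ‖x‖ K) (by fun_prop) hbd
  have hle : ∫ x, min ‖x‖ K ∂μ ≤ ∫ x, ‖x‖ ∂μ :=
    integral_mono ((integrable_const K).mono' (by fun_prop) (ae_of_all _ hbd)) hint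
      fun x => min_le_left _ _
  filter_upwards [hlim.eventually_le_const
    (show ∫ x, min ‖x‖ K ∂μ < ∫ x, ‖x‖ ∂μ + ε / 2 by linarith)]
    with n hn
  have := hν.isProbabilityMeasure_levyApprox γ n
  have hi : Integrable (fun x => min ‖x‖ K) (levyApprox γ ν n) :=
    (integrable_const K).mono' (by fun_prop) (ae_of_all _ hbd)
  have hi2 := (hC n).1.const_mul (2 / (b ^ 2 * K))
  have h1 : ∫ x, ‖x‖ ∂(levyApprox γ ν n) ≤ ∫ x, min ‖x‖ K ∂(levyApprox γ ν n) +
      2 / (b ^ 2 * K) * ∫ x, Real.exp (b * ‖x‖) ∂(levyApprox γ ν n) := by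
    rw [← integral_const_mul, ← integral_add hi hi2]
    exact integral_mono_of_nonneg (ae_of_all _ fun x => norm_nonneg x) (hi.add hi2)
      (ae_of_all _ fun x => norm_le_min_add_exp hb0 hK0 (norm_nonneg x))
  have h2 : 2 / (b ^ 2 * K) * ∫ x, Real.exp (b * ‖x‖) ∂(levyApprox γ ν n) ≤
      2 / (b ^ 2 * K) * C := by
    gcongr
    exact (hC n).2
  linarith

/-- A Laplace transform bound which holds for the approximations passes to the limit. -/
lemma integral_exp_norm_le_of_levyApprox (hν : IsLevyMeasure ν)
    (hμ : ∀ t, charFun μ t = Complex.exp (levyExponent γ ν t)) {c : ℝ} (hc : 0 < c)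
    (h : IntegrableOn (fun u => Real.exp (c * ‖u‖)) {u | 1 < ‖u‖} ν)
    (hint : Integrable (fun x => ‖x‖) μ) {t A : ℝ} (ht : 0 < t)
    (hexp : Integrable (fun x => Real.exp (t * ‖x‖)) μ)
    (hA : ∀ᶠ n in atTop, Integrable (fun x => Real.exp (t * ‖x‖)) (levyApprox γ ν n) ∧
      ∫ x, Real.exp (t * ‖x‖) ∂(levyApprox γ ν n) ≤
        Real.exp (t * ∫ x, ‖x‖ ∂(levyApprox γ ν n) + A)) :
    ∫ x, Real.exp (t * ‖x‖) ∂μ ≤ Real.exp (t * ∫ x, ‖x‖ ∂μ + A) := by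
  have key : ∀ ε > 0, ∀ K : ℕ, ∫ x, min (Real.exp (t * ‖x‖)) (K : ℝ) ∂μ ≤
      Real.exp (t * (∫ x, ‖x‖ ∂μ + ε) + A) := by
    intro ε hε K
    have hbd : ∀ x : EuclideanSpace ℝ (Fin d), ‖min (Real.exp (t * ‖x‖)) (K : ℝ)‖ ≤ K := fun x => by
      rw [Real.norm_of_nonneg (by positivity)]; exact min_le_right _ _
    refine le_of_tendsto (tendsto_integral_levyApprox hν hμ
      (f := fun x => min (Real.exp (t * ‖x‖)) (K : ℝ)) (by fun_prop) hbd) ?_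
    filter_upwards [hA, eventually_integral_norm_levyApprox_le hν hμ hc h hint hε] with n hn1 hn2
    have := hν.isProbabilityMeasure_levyApprox γ n
    refine (integral_mono ((integrable_const (K : ℝ)).mono' (by fun_prop) (ae_of_all _ hbd)) hn1.1
      fun x => min_le_left _ _).trans (hn1.2.trans ?_)
    gcongr
  have key2 : ∀ ε > 0, ∫ x, Real.exp (t * ‖x‖) ∂μ ≤ Real.exp (t * (∫ x, ‖x‖ ∂μ + ε) + A) := by
    intro ε hε
    refine le_of_tendsto' (tendsto_integral_of_dominated_convergence
      (F := fun (K : ℕ) x => min (Real.exp (t * ‖x‖)) (K : ℝ)) (fun x => Real.exp (t * ‖x‖))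
      (fun K => by fun_prop) hexp (fun K => ae_of_all _ fun x => ?_) (ae_of_all _ fun x => ?_))
      (key ε hε)
    · rw [Real.norm_of_nonneg (by positivity)]; exact min_le_left _ _
    · refine tendsto_const_nhds.congr' ?_
      obtain ⟨K₀, hK₀⟩ := exists_nat_ge (Real.exp (t * ‖x‖))
      filter_upwards [eventually_ge_atTop K₀] with K hK
      rw [min_eq_left (hK₀.trans (by exact_mod_cast hK))]
  have hlim : Tendsto (fun ε : ℝ => Real.exp (t * (∫ x, ‖x‖ ∂μ + ε) + A)) (𝓝[>] 0)
      (𝓝 (Real.exp (t * (∫ x, ‖x‖ ∂μ + 0) + A))) :=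
    tendsto_nhdsWithin_of_tendsto_nhds (Continuous.tendsto (by fun_prop) 0)
  rw [add_zero] at hlim
  exact ge_of_tendsto hlim (eventually_nhdsWithin_of_forall fun ε hε => key2 ε hε)

end LimitInequality

section AxesLevy

variable {d : ℕ} {ρ : Measure ℝ}

lemma restrict_farSet_axesMeasure (n : ℕ) :
    (axesMeasure d ρ).restrict (farSet _ n) = axesMeasure d (ρ.restrict (farSet ℝ n)) := by
  have h : ∀ k : Fin d, (fun x : ℝ => EuclideanSpace.single k x) ⁻¹'
      (farSet (EuclideanSpace ℝ (Fin d)) n) = farSet ℝ n := by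
    intro k
    ext x
    simp [farSet]
  simp only [axesMeasure, ← Measure.sum_fintype]
  rw [Measure.restrict_sum _ (measurableSet_farSet n)]
  congr 1
  ext1 k
  rw [Measure.restrict_map (measurable_euclideanSpace_single k) (measurableSet_farSet n), h k]

lemma integrableOn_exp_abs_of_axesMeasure [NeZero d] {c : ℝ}
    (h : IntegrableOn (fun u => Real.exp (c * ‖u‖)) {u | 1 < ‖u‖} (axesMeasure d ρ)) :
    IntegrableOn (fun x => Real.exp (c * |x|)) {x | 1 < |x|} ρ := by
  have hS : MeasurableSet {u : EuclideanSpace ℝ (Fin d) | 1 < ‖u‖} :=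
    (isOpen_lt continuous_const continuous_norm).measurableSet
  have hS1 : MeasurableSet {x : ℝ | 1 < |x|} :=
    (isOpen_lt continuous_const continuous_abs).measurableSet
  rw [← integrable_indicator_iff hS, integrable_axesMeasure_iff
    ((Measurable.indicator (by fun_prop) hS).stronglyMeasurable)] at h
  rw [← integrable_indicator_iff hS1]
  refine (h 0).congr (ae_of_all _ fun x => ?_)
  simp [Set.indicator]

lemma integrable_min_one_sq (hρ : IsLevyMeasure ρ) : Integrable (fun x : ℝ => min 1 (x ^ 2)) ρ := by
  simpa using hρ.integrable_min

lemma integrable_exp_abs_restrict_farSet (hρ : IsLevyMeasure ρ) {c : ℝ}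
    (h : IntegrableOn (fun x => Real.exp (c * |x|)) {x | 1 < |x|} ρ) (n : ℕ) :
    Integrable (fun x => Real.exp (c * |x|)) (ρ.restrict (farSet ℝ n)) := by
  have := hρ.isFiniteMeasure_restrict_farSet n
  have hS1 : MeasurableSet {x : ℝ | 1 < |x|} :=
    (isOpen_lt continuous_const continuous_abs).measurableSet
  have h1 := (h.mono_measure (Measure.restrict_le_self (s := farSet ℝ n))).integrable_indicator hS1
  refine (h1.add (integrable_const (Real.exp |c|))).mono' (by fun_prop) (ae_of_all _ fun x => ?_)
  rw [Real.norm_eq_abs, Real.abs_exp]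
  simp only [Pi.add_apply]
  by_cases hx : 1 < |x|
  · rw [Set.indicator_of_mem (by exact hx)]
    linarith [Real.exp_pos |c|]
  · rw [Set.indicator_of_notMem (by exact hx), zero_add]
    apply Real.exp_le_exp.2
    nlinarith [le_abs_self c, abs_nonneg x, abs_nonneg c, not_lt.1 hx,
      mul_le_mul_of_nonneg_right (le_abs_self c) (abs_nonneg x)]


end AxesLevy

section RateFun

variable {ρ : Measure ℝ} {c l : ℝ}

lemma integrable_rateFun_integrands (hρ : IsLevyMeasure ρ)
    (h : IntegrableOn (fun x => Real.exp (c * |x|)) {x | 1 < |x|} ρ) {t : ℝ} (ht : 0 ≤ t)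
    (htc : t < c) :
    Integrable (fun u => |u| * (Real.exp (t * |u|) - 1)) ρ ∧
      Integrable (fun u => |u| ^ 3 * (Real.exp (t * |u|) - 1)) ρ := by
  have hm := integrable_min_one_sq hρ
  exact ⟨by simpa using integrable_abs_pow_mul_exp_sub_one ht htc hm h 0,
    integrable_abs_pow_mul_exp_sub_one ht htc hm h 2⟩

lemma exp_mul_abs_sub_one_nonneg {t : ℝ} (ht : 0 ≤ t) (u : ℝ) : 0 ≤ Real.exp (t * |u|) - 1 := by
  linarith [Real.one_le_exp (mul_nonneg ht (abs_nonneg u))]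

lemma rateFun_nonneg (hl : 0 < l) {t : ℝ} (ht : 0 ≤ t) : 0 ≤ rateFun ρ l t := by
  have h1 : 0 ≤ ∫ u, |u| * (Real.exp (t * |u|) - 1) ∂ρ :=
    integral_nonneg fun u => mul_nonneg (abs_nonneg u) (exp_mul_abs_sub_one_nonneg ht u)
  have h3 : 0 ≤ ∫ u, |u| ^ 3 * (Real.exp (t * |u|) - 1) ∂ρ :=
    integral_nonneg fun u => mul_nonneg (by positivity) (exp_mul_abs_sub_one_nonneg ht u)
  have := Real.log_nonneg (one_le_two)
  rw [rateFun]
  positivity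

/-- The rate function is nondecreasing in `t` and in the Lévy measure. -/
lemma rateFun_restrict_le (hρ : IsLevyMeasure ρ)
    (h : IntegrableOn (fun x => Real.exp (c * |x|)) {x | 1 < |x|} ρ) (hl : 0 < l) {s t : ℝ}
    (hs : 0 ≤ s) (hst : s ≤ t) (htc : t < c) (S : Set ℝ) :
    rateFun (ρ.restrict S) l s ≤ rateFun ρ l t := by
  have hS := integrable_rateFun_integrands hρ h hs (hst.trans_lt htc)
  have hT := integrable_rateFun_integrands hρ h (hs.trans hst) htc
  have := Real.log_nonneg (one_le_two)
  have h1 : ∫ u in S, |u| * (Real.exp (s * |u|) - 1) ∂ρ ≤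
      ∫ u, |u| * (Real.exp (t * |u|) - 1) ∂ρ := by
    refine (setIntegral_le_integral hS.1 (ae_of_all _ fun u =>
      mul_nonneg (abs_nonneg u) (exp_mul_abs_sub_one_nonneg hs u))).trans
      (integral_mono hS.1 hT.1 fun u => ?_)
    simp only
    gcongr
  have h3 : ∫ u in S, |u| ^ 3 * (Real.exp (s * |u|) - 1) ∂ρ ≤
      ∫ u, |u| ^ 3 * (Real.exp (t * |u|) - 1) ∂ρ := by
    refine (setIntegral_le_integral hS.2 (ae_of_all _ fun u =>
      mul_nonneg (by positivity) (exp_mul_abs_sub_one_nonneg hs u))).trans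
      (integral_mono hS.2 hT.2 fun u => ?_)
    simp only
    gcongr
  rw [rateFun, rateFun]
  gcongr

/-- The condition `t g(t) ≤ 1 / 2` bounds `g` by `1 / T` on `(0, T)`, since `g` is nondecreasing.
This covers `T = M`, where `g(T)` itself carries no information. -/
lemma intervalIntegrable_of_mul_le_half {g : ℝ → ℝ} {T : ℝ} (hT : 0 ≤ T)
    (hmono : MonotoneOn g (Set.Ioo 0 T)) (hnonneg : ∀ s ∈ Set.Ioo 0 T, 0 ≤ g s)
    (hhalf : ∀ s ∈ Set.Ioo 0 T, s * g s ≤ 1 / 2) :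
    IntervalIntegrable (fun s => 2 * g s) volume 0 T := by
  refine IntervalIntegrable.const_mul ?_ 2
  rw [intervalIntegrable_iff_integrableOn_Ioo_of_le hT]
  refine (integrable_const (1 / T)).mono'
    (aemeasurable_restrict_of_monotoneOn measurableSet_Ioo hmono).aestronglyMeasurable ?_
  refine (ae_restrict_iff' measurableSet_Ioo).2 (ae_of_all _ fun s hs => ?_)
  have hT0 : 0 < T := hs.1.trans hs.2
  rw [Real.norm_of_nonneg (hnonneg s hs)]
  have key : ∀ r ∈ Set.Ioo 0 T, T / 2 ≤ r → g r ≤ 1 / T := by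
    intro r hr hr2
    have := mul_le_mul_of_nonneg_right hr2 (hnonneg r hr)
    have := hhalf r hr
    rw [le_div_iff₀ hT0]
    linarith
  rcases le_total (T / 2) s with h | h
  · exact key s hs h
  · have h2 : T / 2 ∈ Set.Ioo 0 T := ⟨by linarith, by linarith⟩
    exact (hmono hs h2 h).trans (key _ h2 le_rfl)

end RateFun

/-! ### The concentration inequality -/

section NonDegenerate

variable {d : ℕ} {ν : Measure (EuclideanSpace ℝ (Fin d))} {γ : EuclideanSpace ℝ (Fin d)}

/-- The Lévy measure of the unit mass at `0` vanishes. The real part of its exponent is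
`-∫ (1 - cos ⟨t, u⟩) ν(du)`, so `⟨t, u⟩ ∈ 2π ℤ` for almost every `u`; letting `t` run through
`e_k / (m + 1)` leaves only `u = 0`. -/
lemma levyMeasure_eq_zero_of_charFun_eq_one (hν : IsLevyMeasure ν)
    (h : ∀ t, Complex.exp (levyExponent γ ν t) = 1) : ν = 0 := by
  have hcos : ∀ t : EuclideanSpace ℝ (Fin d), ∀ᵐ u ∂ν, Real.cos ⟪t, u⟫ = 1 := by
    intro t
    have h1 : (levyExponent γ ν t).re = 0 := by
      have := congrArg norm (h t)
      rw [Complex.norm_exp, norm_one, Real.exp_eq_one_iff] at this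
      exact this
    have hk := integrable_levyKernel_I hν t
    have h2 : ∫ u, (levyKernel I t u).re ∂ν = 0 := by
      have h3 : levyExponent γ ν t = I * ((⟪t, γ⟫ : ℝ) : ℂ) + ∫ u, levyKernel I t u ∂ν := rfl
      rw [h3, Complex.add_re, Complex.I_mul_re, Complex.ofReal_im, neg_zero, zero_add] at h1
      rw [← h1]
      exact integral_re hk
    have hre : ∀ u, (levyKernel I t u).re = Real.cos ⟪t, u⟫ - 1 := by
      intro u
      rw [levyKernel, Complex.sub_re, Complex.sub_re, mul_comm I, Complex.exp_ofReal_mul_I_re,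
        Complex.one_re]
      by_cases hu : u ∈ Metric.closedBall (0 : EuclideanSpace ℝ (Fin d)) 1
      · rw [Set.indicator_of_mem hu]; simp
      · rw [Set.indicator_of_notMem hu]; simp
    have hi : Integrable (fun u => 1 - Real.cos ⟪t, u⟫) ν :=
      hk.re.neg.congr (ae_of_all _ fun u => by
        change -(levyKernel I t u).re = _
        rw [hre]; ring)
    have h4 : ∫ u, (1 - Real.cos ⟪t, u⟫) ∂ν = 0 := by
      rw [← neg_eq_zero, ← integral_neg, ← h2]
      exact integral_congr_ae (ae_of_all _ fun u => by simp only [hre]; ring)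
    rw [integral_eq_zero_iff_of_nonneg (fun u => sub_nonneg.2 (Real.cos_le_one _)) hi] at h4
    filter_upwards [h4] with u hu
    have : 1 - Real.cos ⟪t, u⟫ = 0 := hu
    linarith
  have hall : ∀ᵐ u ∂ν, ∀ k : Fin d, ∀ m : ℕ,
      Real.cos ⟪EuclideanSpace.single k (((m : ℝ) + 1)⁻¹), u⟫ = 1 :=
    ae_all_iff.2 fun k => ae_all_iff.2 fun m => hcos _
  have hzero : ∀ᵐ u ∂ν, u = 0 := by
    filter_upwards [hall] with u hu
    ext k
    obtain ⟨m, hm⟩ := exists_nat_ge |u k|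
    have h1 := hu k m
    rw [EuclideanSpace.inner_single_left, conj_trivial] at h1
    have hm0 : (0 : ℝ) < (m : ℝ) + 1 := by positivity
    have h2 : |((m : ℝ) + 1)⁻¹ * u k| < 2 * Real.pi := by
      rw [abs_mul, abs_of_pos (inv_pos.2 hm0), inv_mul_lt_iff₀ hm0]
      nlinarith [Real.pi_gt_three]
    rw [Real.cos_eq_one_iff_of_lt_of_lt (abs_lt.1 h2).1 (abs_lt.1 h2).2] at h1
    simpa [hm0.ne'] using h1
  have h5 : ν {0}ᶜ = 0 := by rw [ae_iff] at hzero; exact hzero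
  rw [← Measure.measure_univ_eq_zero, ← Set.union_compl_self {(0 : EuclideanSpace ℝ (Fin d))}]
  exact measure_union_null hν.zero_atom h5

end NonDegenerate

section RandomVector

variable {Ω : Type*} [MeasurableSpace Ω] {P : Measure Ω} {d : ℕ}
  {X : Ω → EuclideanSpace ℝ (Fin d)}

lemma exists_integrable_of_lt_expMomentSup {Y : Ω → ℝ} {t : ℝ}
    (h : (t : EReal) < expMomentSup Y P) :
    ∃ c : ℝ, t < c ∧ 0 < c ∧ Integrable (fun ω => Real.exp (c * |Y ω|)) P := by
  rw [expMomentSup, lt_iSup_iff] at h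
  obtain ⟨c, hc⟩ := h
  rw [lt_iSup_iff] at hc
  obtain ⟨⟨hc0, hci⟩, htc⟩ := hc
  exact ⟨c, by exact_mod_cast htc, hc0, hci⟩

lemma EuclideanSpace.norm_le_sum_abs (x : EuclideanSpace ℝ (Fin d)) : ‖x‖ ≤ ∑ k, |x k| := by
  refine abs_le_of_sq_le_sq' ?_ (Finset.sum_nonneg fun k _ => abs_nonneg _) |>.2
  rw [EuclideanSpace.real_norm_sq_eq]
  calc ∑ k, x k ^ 2 = ∑ k, |x k| ^ 2 := by simp
    _ ≤ _ := Finset.sum_sq_le_sq_sum_of_nonneg fun k _ => abs_nonneg _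

variable [NeZero d]

lemma integral_exp_neg_norm_sq (hX : AEMeasurable X P)
    (hindep : iIndepFun (fun k ω => X ω k) P)
    (hident : ∀ k : Fin d, IdentDistrib (fun ω => X ω k) (fun ω => X ω 0) P P) :
    ∫ ω, Real.exp (-‖X ω‖ ^ 2) ∂P = (∫ ω, Real.exp (-(X ω 0) ^ 2) ∂P) ^ d := by
  have hind : iIndepFun (fun k ω => (X ω k) ^ 2) P :=
    hindep.comp (fun _ y => y ^ 2) (fun _ => by fun_prop)
  have hmgf := hind.mgf_sum₀ (t := -1) (fun k => by fun_prop) Finset.univ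
  have h1 : ∀ k, mgf (fun ω => (X ω k) ^ 2) P (-1) = ∫ ω, Real.exp (-(X ω 0) ^ 2) ∂P := by
    intro k
    have := ((hident k).comp (u := fun y : ℝ => Real.exp (-y ^ 2)) (by fun_prop)).integral_eq
    simpa [mgf, Function.comp_def] using this
  rw [Finset.prod_congr rfl fun k _ => h1 k, Finset.prod_const, Finset.card_univ,
    Fintype.card_fin] at hmgf
  rw [← hmgf, mgf]
  congr 1
  ext ω
  beta_reduce
  rw [Finset.sum_apply, EuclideanSpace.real_norm_sq_eq, neg_one_mul]

variable [IsProbabilityMeasure P]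

/-- Exponential moments of the norm follow from those of one coordinate, by independence. -/
lemma integrable_exp_norm_of_coord (hX : AEMeasurable X P)
    (hindep : iIndepFun (fun k ω => X ω k) P)
    (hident : ∀ k : Fin d, IdentDistrib (fun ω => X ω k) (fun ω => X ω 0) P P) {c : ℝ} (hc : 0 ≤ c)
    (h : Integrable (fun ω => Real.exp (c * |X ω 0|)) P) :
    Integrable (fun ω => Real.exp (c * ‖X ω‖)) P := by
  have hk : ∀ k, Integrable (fun ω => Real.exp (c * |X ω k|)) P := fun k =>
    ((hident k).comp (u := fun y : ℝ => Real.exp (c * |y|)) (by fun_prop)).integrable_iff.2 h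
  have hind : iIndepFun (fun k ω => |X ω k|) P :=
    hindep.comp (fun _ y => |y|) (fun _ => by fun_prop)
  have hmeas : ∀ k : Fin d, AEMeasurable (fun ω => |X ω k|) P := fun k => by fun_prop
  have hmgf := hind.mgf_sum₀ (t := c) hmeas Finset.univ
  have hpos : 0 < mgf (∑ k, fun ω => |X ω k|) P c := by
    rw [hmgf]
    exact Finset.prod_pos fun k _ => mgf_pos (hk k)
  -- a non-integrable function would have vanishing Bochner integral
  have hsum : Integrable (fun ω => Real.exp (c * (∑ k, fun ω => |X ω k|) ω)) P := by
    by_contra hcon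
    rw [mgf, integral_undef hcon] at hpos
    exact lt_irrefl _ hpos
  refine hsum.mono' (by fun_prop) (ae_of_all _ fun ω => ?_)
  rw [Real.norm_eq_abs, Real.abs_exp, Finset.sum_apply]
  gcongr
  exact EuclideanSpace.norm_le_sum_abs (X ω)

lemma integrable_exp_neg_sq {Y : Ω → ℝ} (hY : AEMeasurable Y P) :
    Integrable (fun ω => Real.exp (-(Y ω) ^ 2)) P := by
  refine (integrable_const (1 : ℝ)).mono' (by fun_prop) (ae_of_all _ fun ω => ?_)
  rw [Real.norm_eq_abs, Real.abs_exp, Real.exp_le_one_iff]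
  linarith [sq_nonneg (Y ω)]

lemma negLogLaplaceSq_pos {Y : Ω → ℝ} (hY : AEMeasurable Y P) (h : ¬ ∀ᵐ ω ∂P, Y ω = 0) :
    0 < negLogLaplaceSq Y P := by
  have hi := integrable_exp_neg_sq hY
  have hle : ∀ ω, Real.exp (-(Y ω) ^ 2) ≤ 1 := fun ω => by
    rw [Real.exp_le_one_iff]; linarith [sq_nonneg (Y ω)]
  have h0 : 0 < ∫ ω, Real.exp (-(Y ω) ^ 2) ∂P := integral_exp_pos hi
  have h1 : ∫ ω, Real.exp (-(Y ω) ^ 2) ∂P < 1 := by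
    refine lt_of_le_of_ne ?_ fun heq => h ?_
    · calc ∫ ω, Real.exp (-(Y ω) ^ 2) ∂P ≤ ∫ _ω, (1 : ℝ) ∂P :=
            integral_mono hi (integrable_const _) hle
        _ = 1 := by simp
    · have h2 : ∫ ω, (1 - Real.exp (-(Y ω) ^ 2)) ∂P = 0 := by
        rw [integral_sub (integrable_const _) hi, heq]; simp
      rw [integral_eq_zero_iff_of_nonneg (fun ω => sub_nonneg.2 (hle ω))
        ((integrable_const _).sub hi)] at h2
      filter_upwards [h2] with ω hω
      have h3 : Real.exp (-(Y ω) ^ 2) = 1 := by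
        have : 1 - Real.exp (-(Y ω) ^ 2) = 0 := hω
        linarith
      rw [Real.exp_eq_one_iff] at h3
      exact pow_eq_zero_iff two_ne_zero |>.1 (by linarith)
  rw [negLogLaplaceSq, neg_pos]
  exact Real.log_neg h0 h1

lemma negLogLaplaceSq_coord_pos {γ : EuclideanSpace ℝ (Fin d)}
    {ν : Measure (EuclideanSpace ℝ (Fin d))} (hX : IsInfDivVector X P γ ν) (hν : ν ≠ 0)
    (hident : ∀ k : Fin d, IdentDistrib (fun ω => X ω k) (fun ω => X ω 0) P P) :
    0 < negLogLaplaceSq (fun ω => X ω 0) P := by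
  have hXm := hX.aemeasurable
  refine negLogLaplaceSq_pos (by fun_prop) fun h0 => hν ?_
  refine levyMeasure_eq_zero_of_charFun_eq_one (γ := γ) hX.isLevyMeasure fun t => ?_
  have hX0 : ∀ᵐ ω ∂P, X ω = 0 := by
    have : ∀ᵐ ω ∂P, ∀ k, X ω k = 0 := ae_all_iff.2 fun k =>
      (hident k).symm.ae_snd (p := fun y => y = 0) (measurableSet_singleton 0) h0
    filter_upwards [this] with ω hω
    ext k
    exact hω k
  rw [← hX.charFun_eq, charFun_apply, integral_map hXm (by fun_prop)]
  calc ∫ ω, Complex.exp (⟪X ω, t⟫ * I) ∂P = ∫ _ω, (1 : ℂ) ∂P := by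
        refine integral_congr_ae ?_
        filter_upwards [hX0] with ω hω
        rw [hω]
        simp
    _ = 1 := by simp

/-- The Laplace transform bound for `‖X‖`, from the one for its compound Poisson approximations. -/
lemma integral_exp_norm_le_of_isInfDivVector {γ : EuclideanSpace ℝ (Fin d)} {ρ : Measure ℝ}
    (hX : IsInfDivVector X P γ (axesMeasure d ρ)) (hρ : IsLevyMeasure ρ)
    (hindep : iIndepFun (fun k ω => X ω k) P)
    (hident : ∀ k : Fin d, IdentDistrib (fun ω => X ω k) (fun ω => X ω 0) P P)
    {l : ℝ} (hl : l = negLogLaplaceSq (fun ω => X ω 0) P) (hl0 : 0 < l)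
    {t c : ℝ} (ht : 0 < t) (htc : t < c) (hc : Integrable (fun ω => Real.exp (c * ‖X ω‖)) P)
    {g : ℝ → ℝ} (hg : ∀ s, 0 < s → s < t → g s = rateFun ρ l s)
    (hgi : IntervalIntegrable (fun s => 2 * g s) volume 0 t)
    (hhalf : ∀ s, 0 < s → s < t → s * g s ≤ 1 / 2) :
    ∫ ω, Real.exp (t * ‖X ω‖) ∂P ≤
      Real.exp (t * ∫ ω, ‖X ω‖ ∂P + ∫ s in (0 : ℝ)..t, 2 * g s) := by
  have hXm := hX.aemeasurable
  have hν := hX.isLevyMeasure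
  have hc0 : 0 < c := ht.trans htc
  have : IsProbabilityMeasure (P.map X) := Measure.isProbabilityMeasure_map hXm
  have tr : ∀ f : EuclideanSpace ℝ (Fin d) → ℝ, Continuous f →
      ∫ ω, f (X ω) ∂P = ∫ x, f x ∂(P.map X) := fun f hf =>
    (integral_map hXm hf.aestronglyMeasurable).symm
  have tri : ∀ f : EuclideanSpace ℝ (Fin d) → ℝ, Continuous f →
      Integrable (fun ω => f (X ω)) P → Integrable f (P.map X) := fun f hf hi =>
    (integrable_map_measure hf.aestronglyMeasurable hXm).2 hi
  have hcμ := tri (fun x => Real.exp (c * ‖x‖)) (by fun_prop) hc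
  have hbig := integrableOn_exp_norm_of_integrable hν hX.charFun_eq hc0.le hcμ
  have hbigρ := integrableOn_exp_abs_of_axesMeasure hbig
  have htμ : Integrable (fun x => Real.exp (t * ‖x‖)) (P.map X) :=
    hcμ.mono' (by fun_prop) (ae_of_all _ fun x => by
      rw [Real.norm_eq_abs, Real.abs_exp]; gcongr)
  have hnμ : Integrable (fun x => ‖x‖) (P.map X) := by
    refine (hcμ.const_mul c⁻¹).mono' (by fun_prop) (ae_of_all _ fun x => ?_)
    rw [norm_norm, inv_mul_eq_div, le_div_iff₀ hc0]
    linarith [Real.add_one_le_exp (c * ‖x‖)]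
  -- the small ball estimate passes to the approximations with a factor `2` to spare
  have hsmall : ∫ x, Real.exp (-‖x‖ ^ 2) ∂(P.map X) < 2 * Real.exp (-(l * d)) := by
    rw [← tr (fun x => Real.exp (-‖x‖ ^ 2)) (by fun_prop),
      integral_exp_neg_norm_sq hXm hindep hident]
    have h0 : 0 < ∫ ω, Real.exp (-(X ω 0) ^ 2) ∂P :=
      integral_exp_pos (integrable_exp_neg_sq (by fun_prop))
    have e : ∫ ω, Real.exp (-(X ω 0) ^ 2) ∂P = Real.exp (-l) := by
      rw [hl, negLogLaplaceSq, neg_neg, Real.exp_log h0]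
    rw [e, ← Real.exp_nat_mul]
    have e2 : (d : ℝ) * -l = -(l * d) := by ring
    rw [e2]
    linarith [Real.exp_pos (-(l * d))]
  have hlim := tendsto_integral_levyApprox hν hX.charFun_eq
    (f := fun x => Real.exp (-‖x‖ ^ 2)) (by fun_prop) (B := 1) (fun x => by
      rw [Real.norm_eq_abs, Real.abs_exp, Real.exp_le_one_iff]; linarith [sq_nonneg ‖x‖])
  rw [tr (fun x => Real.exp (t * ‖x‖)) (by fun_prop), tr (fun x => ‖x‖) (by fun_prop)]
  refine integral_exp_norm_le_of_levyApprox hν hX.charFun_eq hc0 hbig hnμ ht htμ ?_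
  filter_upwards [hlim.eventually_le_const hsmall] with n hn
  have := hρ.isFiniteMeasure_restrict_farSet n
  have hρn := integrable_exp_abs_restrict_farSet hρ hbigρ n
  rw [levyApprox, restrict_farSet_axesMeasure] at hn ⊢
  refine ⟨(integrable_exp_norm_shiftedCompoundPoisson _ _ hc0.le
    (integrable_exp_norm_axesMeasure hρn)).mono' (by fun_prop) (ae_of_all _ fun x => by
      rw [Real.norm_eq_abs, Real.abs_exp]; gcongr), ?_⟩
  refine integral_exp_norm_le _ ht.le htc hl0 hρn hn hgi (fun s hs hst => ?_) hhalf
  rw [hg s hs hst]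
  exact rateFun_restrict_le hρ hbigρ hl0 hs.le le_rfl (hst.trans htc) _

end RandomVector

theorem theorem1 {Ω : Type*} [MeasurableSpace Ω] (P : Measure Ω) [IsProbabilityMeasure P]
    (d : ℕ) [NeZero d] (X : Ω → EuclideanSpace ℝ (Fin d))
    (γ : EuclideanSpace ℝ (Fin d)) (ν : Measure (EuclideanSpace ℝ (Fin d))) (ρ : Measure ℝ)
    (hX : IsInfDivVector X P γ ν) (hν : ν ≠ 0)
    (hρ : IsLevyMeasure ρ) (hνρ : ν = axesMeasure d ρ)
    (hindep : iIndepFun (fun k ω => X ω k) P)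
    (hident : ∀ k : Fin d, IdentDistrib (fun ω => X ω k) (fun ω => X ω 0) P P)
    (hexp : ∃ t : ℝ, 0 < t ∧ Integrable (fun ω => Real.exp (t * ‖X ω‖)) P)
    (M : EReal) (hM : M = expMomentSup (fun ω => X ω 0) P)
    (l : ℝ) (hl : l = negLogLaplaceSq (fun ω => X ω 0) P)
    (g : ℝ → ℝ) (hg : ∀ t : ℝ, 0 < t → (t : EReal) < M → g t = rateFun ρ l t) :
    -- the quantities in the inequality are well defined
    0 < l ∧ Integrable (fun ω => ‖X ω‖) P ∧
    (∀ t : ℝ, 0 < t → (t : EReal) < M →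
      Integrable (fun u => |u| * (Real.exp (t * |u|) - 1)) ρ ∧
      Integrable (fun u => |u| ^ 3 * (Real.exp (t * |u|) - 1)) ρ) ∧
    ∀ T : ℝ, 0 ≤ T → (T : EReal) ≤ M →
      (∀ t : ℝ, 0 < t → t ≤ T → (t : EReal) < M → t * g t ≤ 1 / 2) →
      IntervalIntegrable (fun s => 2 * g s) volume 0 T ∧
      ∀ x : ℝ, 0 < x →
        BddAbove (Set.range fun t : Set.Icc (0 : ℝ) T =>
          (t : ℝ) * x - ∫ s in (0 : ℝ)..t, 2 * g s) ∧
        P.real {ω | (∫ ω', ‖X ω'‖ ∂P) + x ≤ ‖X ω‖} ≤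
          Real.exp (-⨆ t : Set.Icc (0 : ℝ) T, ((t : ℝ) * x - ∫ s in (0 : ℝ)..t, 2 * g s)) := by
  have hXm := hX.aemeasurable
  have hl0 : 0 < l := hl ▸ negLogLaplaceSq_coord_pos hX hν hident
  subst hνρ
  have : IsProbabilityMeasure (P.map X) := Measure.isProbabilityMeasure_map hXm
  have hnorm : Integrable (fun ω => ‖X ω‖) P := by
    obtain ⟨t, ht, hti⟩ := hexp
    refine (hti.const_mul t⁻¹).mono' (by fun_prop) (ae_of_all _ fun ω => ?_)
    rw [norm_norm, inv_mul_eq_div, le_div_iff₀ ht]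
    linarith [Real.add_one_le_exp (t * ‖X ω‖)]
  -- exponential moments of `X` and of the Lévy measure beyond any `t < M`
  have hmom : ∀ t : ℝ, (t : EReal) < M → ∃ c, t < c ∧ 0 < c ∧
      Integrable (fun ω => Real.exp (c * ‖X ω‖)) P ∧
      IntegrableOn (fun x => Real.exp (c * |x|)) {x | 1 < |x|} ρ := by
    intro t htM
    obtain ⟨c, htc, hc0, hci⟩ := exists_integrable_of_lt_expMomentSup (hM ▸ htM)
    have hcX := integrable_exp_norm_of_coord hXm hindep hident hc0.le hci
    refine ⟨c, htc, hc0, hcX, integrableOn_exp_abs_of_axesMeasure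
      (integrableOn_exp_norm_of_integrable hX.isLevyMeasure hX.charFun_eq hc0.le ?_)⟩
    exact (integrable_map_measure (by fun_prop) hXm).2 hcX
  refine ⟨hl0, hnorm, fun t ht htM => ?_, fun T hT hTM hhalf => ?_⟩
  · obtain ⟨c, htc, -, -, hc⟩ := hmom t htM
    exact integrable_rateFun_integrands hρ hc ht.le htc
  have hlt : ∀ s : ℝ, s < T → (s : EReal) < M := fun s hs =>
    (EReal.coe_lt_coe_iff.2 hs).trans_le hTM
  have hgr : ∀ s ∈ Set.Ioo 0 T, g s = rateFun ρ l s := fun s hs => hg s hs.1 (hlt s hs.2)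
  have hg0 : ∀ s ∈ Set.Ioo 0 T, 0 ≤ g s := fun s hs => by
    rw [hgr s hs]; exact rateFun_nonneg hl0 hs.1.le
  have hgi : IntervalIntegrable (fun s => 2 * g s) volume 0 T := by
    refine intervalIntegrable_of_mul_le_half hT (fun s hs t ht hst => ?_) hg0
      fun s hs => hhalf s hs.1 hs.2.le (hlt s hs.2)
    obtain ⟨c, htc, -, -, hc⟩ := hmom t (hlt t ht.2)
    rw [hgr s hs, hgr t ht]
    simpa using rateFun_restrict_le hρ hc hl0 hs.1.le hst htc Set.univ
  refine ⟨hgi, fun x hx => ?_⟩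
  have hcont : ContinuousOn (fun t : ℝ => t * x - ∫ s in (0 : ℝ)..t, 2 * g s) (Set.Icc 0 T) := by
    have h := intervalIntegral.continuousOn_primitive_interval' hgi (a := 0) (by simp [hT])
    rw [Set.uIcc_of_le hT] at h
    exact (continuousOn_id.mul continuousOn_const).sub h
  set p := P.real {ω | (∫ ω', ‖X ω'‖ ∂P) + x ≤ ‖X ω‖}
  have hchernoff : ∀ t, 0 < t → t < T →
      p ≤ Real.exp (-(t * x - ∫ s in (0 : ℝ)..t, 2 * g s)) := by
    intro t ht htT
    obtain ⟨c, htc, -, hcX, -⟩ := hmom t (hlt t htT)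
    have hti : Integrable (fun ω => Real.exp (t * ‖X ω‖)) P :=
      hcX.mono' (by fun_prop) (ae_of_all _ fun ω => by
        rw [Real.norm_eq_abs, Real.abs_exp]; gcongr)
    have h1 := measure_ge_le_exp_mul_mgf (μ := P) (X := fun ω => ‖X ω‖)
      ((∫ ω', ‖X ω'‖ ∂P) + x) ht.le hti
    have h2 := integral_exp_norm_le_of_isInfDivVector hX hρ hindep hident hl hl0 ht htc hcX
      (fun s hs hst => hgr s ⟨hs, hst.trans htT⟩)
      (hgi.mono_set (by
        rw [Set.uIcc_of_le hT, Set.uIcc_of_le ht.le]; exact Set.Icc_subset_Icc_right htT.le))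
      (fun s hs hst => hhalf s hs (hst.trans htT).le (hlt s (hst.trans htT)))
    refine h1.trans ((mul_le_mul_of_nonneg_left h2 (Real.exp_pos _).le).trans_eq ?_)
    rw [← Real.exp_add]
    congr 1
    ring
  have hall : ∀ t ∈ Set.Icc 0 T, p ≤ Real.exp (-(t * x - ∫ s in (0 : ℝ)..t, 2 * g s)) := by
    intro t ht
    rcases ht.1.eq_or_lt with h0 | h0
    · rw [← h0]
      simpa using measureReal_le_one
    rcases ht.2.eq_or_lt with hTt | hTt
    · -- the endpoint `T`, possibly equal to `M`, is reached by continuity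
      subst hTt
      have hlim : Tendsto (fun r : ℝ => Real.exp (-(r * x - ∫ s in (0 : ℝ)..r, 2 * g s)))
          (𝓝[<] t) (𝓝 (Real.exp (-(t * x - ∫ s in (0 : ℝ)..t, 2 * g s)))) := by
        have h := (hcont t ht).neg.rexp
        refine h.mono_left ?_
        rw [← nhdsWithin_Ioo_eq_nhdsLT h0]
        exact nhdsWithin_mono _ Set.Ioo_subset_Icc_self
      refine ge_of_tendsto hlim ?_
      filter_upwards [Ioo_mem_nhdsLT h0] with r hr using hchernoff r hr.1 hr.2
    · exact hchernoff t h0 hTt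
  constructor
  · have h := (isCompact_Icc.image_of_continuousOn hcont).bddAbove
    rwa [Set.image_eq_range] at h
  · rcases (measureReal_nonneg : 0 ≤ p).eq_or_lt with h0 | h0
    · exact h0.symm.le.trans (Real.exp_pos _).le
    · rw [← Real.log_le_iff_le_exp h0, le_neg]
      have : Nonempty (Set.Icc (0 : ℝ) T) := ⟨⟨0, le_rfl, hT⟩⟩
      refine ciSup_le fun t => ?_
      have h := (Real.log_le_iff_le_exp h0).2 (hall t t.2)
      linarith
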